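/- Let $\gamma>0$. There is a constant $C>0$, depending only on $\gamma$, such that the following holds. Let $E\subset\mathbb R^2$ be (the interior of) a simple polygon, with diameter $h_E$, such that (A1) every edge $e$ of $E$ has length $h_e\ge\gamma h_E$; (A2) $E$ is star-shaped with respect to every point of a ball of radius at least $\gamma h_E$ contained in $E$. Let $$U_h^*(E)=\Bigl\{\mathbf v\in[H^1(E)]^2:\ \Delta\mathbf v=\mathbf 0 \text{ in } E,\quad \frac{\partial\mathbf v}{\partial\mathbf n}\Big|_e\in[\mathbb P_0(e)]^2\ \text{ for every edge } e \text{ of } E\Bigr\},$$ where $\mathbb P_0(e)$ is the space of constants on $e$, the Laplacian is understood in the sense of distributions and the normal derivative $\nabla\mathbf v\,\mathbf n$ in the sense of $[H^{-1/2}(\partial E)]^2$, through Green's formula. Let $\Pi_0^\partial$ be the $L^2(\partial E)$-projection onto the vector fields that are constant on each edge of $E$, that is, $(\Pi_0^\partial\mathbf v)|_e=\frac1{|e|}\int_e\mathbf v\,ds$ for every edge $e$, applied to the trace of $\mathbf v$ on $\partial E$. Write $\|\cdot\|_{0,E}$ and $\|\cdot\|_{0,\partial E}$ for the $L^2$ norms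 and $|\mathbf v|_{1,E}=\|\nabla\mathbf v\|_{0,E}$. Then every $\mathbf v\in U_h^*(E)$ satisfies $$|\mathbf v|_{1,E}\le C\,h_E^{-1}\,\|\mathbf v\|_{0,E}\qquad\text{and}\qquad \|\mathbf v\|_{0,E}\le C\,h_E^{1/2}\,\|\Pi_0^\partial\mathbf v\|_{0,\partial E}.$$ In particular both estimates hold, with one constant $C$, for all elements of all meshes of a family of polygonal meshes satisfying (A1) and (A2) with the same $\gamma$. -/

import Mathlib

open MeasureTheory Filter Topology
open scoped ContDiff Gradient

namespace VEM

/-- The Euclidean plane `ℝ²`. -/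
abbrev Plane : Type := EuclideanSpace ℝ (Fin 2)

/-! ### Polygons -/

/-- The open set `E` is the (open) polygon bounded by the closed polygonal line `P`, and this line is
simple: the half-open edges `[P i, P (i+1))` are pairwise disjoint and nondegenerate (in particular
there are at least three of them). Consecutive edges may be aligned, that is, flat angles at vertices
are allowed. -/
structure IsPolygon {n : ℕ} (P : Polygon Plane n) (E : Set Plane) : Prop where
  isOpen : IsOpen E
  isBounded : Bornology.IsBounded E
  isConnected : IsConnected E
  frontier_eq : frontier E = P.boundary ℝ
  simple : ∀ i j : Fin n, ∀ s ∈ Set.Ico (0 : ℝ) 1, ∀ t ∈ Set.Ico (0 : ℝ) 1,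
    P.edgePath ℝ i s = P.edgePath ℝ j t → i = j ∧ s = t

/-- The length `|e| = h_e` of the `i`-th edge. -/
noncomputable def edgeLength {n : ℕ} (P : Polygon Plane n) (i : Fin n) : ℝ :=
  dist (P i) (P (finRotate n i))

/-- Assumption (A1): every edge has length at least `γ h_E`, where `h_E` is the diameter of `E`. -/
def EdgesLong {n : ℕ} (γ : ℝ) (P : Polygon Plane n) (E : Set Plane) : Prop :=
  ∀ i : Fin n, γ * Metric.diam E ≤ edgeLength P i

/-- Assumption (A2): `E` is star-shaped with respect to (every point of) a ball contained in `E`, of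
radius at least `γ h_E`. -/
def StarShapedWrtBall (γ : ℝ) (E : Set Plane) : Prop :=
  ∃ (x₀ : Plane) (ρ : ℝ), γ * Metric.diam E ≤ ρ ∧ Metric.ball x₀ ρ ⊆ E ∧
    ∀ y ∈ Metric.ball x₀ ρ, StarConvex ℝ y E

/-- The arc length measure `ds` on the `i`-th edge: the image of Lebesgue measure on `[0,1]` under the
affine parametrization of the edge, multiplied by the length of the edge. -/
noncomputable def edgeMeasure {n : ℕ} (P : Polygon Plane n) (i : Fin n) : Measure Plane :=
  ENNReal.ofReal (edgeLength P i) •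
    (volume.restrict (Set.Icc (0 : ℝ) 1)).map (P.edgePath ℝ i)

/-- The arc length measure `ds` on `∂E`. -/
noncomputable def boundaryMeasure {n : ℕ} (P : Polygon Plane n) : Measure Plane :=
  ∑ i, edgeMeasure P i

/-! ### The Sobolev space `H¹(E)` -/

/-- `φ ∈ C_c^∞(E)`. -/
def IsTestFunction (E : Set Plane) (φ : Plane → ℝ) : Prop :=
  ContDiff ℝ ∞ φ ∧ HasCompactSupport φ ∧ tsupport φ ⊆ E

/-- `u ∈ L²(E)` has the weak gradient `g ∈ L²(E)²` in `E`. -/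
structure HasWeakGrad (E : Set Plane) (u : Plane → ℝ) (g : Plane → Plane) : Prop where
  memLp : MemLp u 2 (volume.restrict E)
  memLp_grad : MemLp g 2 (volume.restrict E)
  integral_eq : ∀ φ : Plane → ℝ, IsTestFunction E φ →
    ∫ x in E, u x • ∇ φ x = -∫ x in E, φ x • g x

/-- `u ∈ H¹(E)`. -/
def MemH1 (E : Set Plane) (u : Plane → ℝ) : Prop :=
  ∃ g, HasWeakGrad E u g

open Classical in
/-- The weak gradient of `u ∈ H¹(E)` (unique up to null sets when `E` is open); `0` if
`u ∉ H¹(E)`. -/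
noncomputable def weakGrad (E : Set Plane) (u : Plane → ℝ) : Plane → Plane :=
  if h : MemH1 E u then h.choose else 0

/-- The norm `‖v‖_{0,E}` of `L²(E)²`. -/
noncomputable def normL2 (E : Set Plane) (v : Plane → Plane) : ℝ :=
  √(∫ x in E, ‖v x‖ ^ 2)

/-- The seminorm `|v|_{1,E} = ‖∇v‖_{0,E}` of `H¹(E)²`. -/
noncomputable def seminormH1 (E : Set Plane) (v : Plane → Plane) : ℝ :=
  √(∑ k : Fin 2, ∫ x in E, ‖weakGrad E (fun y ↦ v y k) x‖ ^ 2)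

/-! ### Traces and normal derivatives -/

/-- `t ∈ L²(∂E)` is the trace on `∂E` of `u ∈ H¹(E)`: it is the limit in `L²(∂E)` of the boundary
values of functions `φ_m`, smooth up to the boundary, that converge to `u` in `H¹(E)`. -/
def IsTrace {n : ℕ} (P : Polygon Plane n) (E : Set Plane) (u t : Plane → ℝ) : Prop :=
  MemH1 E u ∧ MemLp t 2 (boundaryMeasure P) ∧
  ∃ φ : ℕ → Plane → ℝ, (∀ m, ContDiff ℝ ∞ (φ m)) ∧
    Tendsto (fun m ↦ eLpNorm (fun x ↦ φ m x - u x) 2 (volume.restrict E)) atTop (𝓝 0) ∧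
    Tendsto (fun m ↦ eLpNorm (fun x ↦ ∇ (φ m) x - weakGrad E u x) 2 (volume.restrict E))
      atTop (𝓝 0) ∧
    Tendsto (fun m ↦ eLpNorm (fun x ↦ φ m x - t x) 2 (boundaryMeasure P)) atTop (𝓝 0)

open Classical in
/-- The trace on `∂E` of `u ∈ H¹(E)` (unique up to null sets); `0` if there is none. -/
noncomputable def trace {n : ℕ} (P : Polygon Plane n) (E : Set Plane) (u : Plane → ℝ) :
    Plane → ℝ :=
  if h : ∃ t, IsTrace P E u t then h.choose else 0

/-- The trace on `∂E` of `v ∈ H¹(E)²`, component by component. -/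
noncomputable def vecTrace {n : ℕ} (P : Polygon Plane n) (E : Set Plane) (v : Plane → Plane) :
    Plane → Plane :=
  fun x ↦ WithLp.toLp 2 fun k ↦ trace P E (fun y ↦ v y k) x

/-- The `L²(∂E)`-projection `Π_0^∂` of a vector field on `∂E` onto the fields that are constant on
each edge; such a field is given by its values on the edges, here the mean values over the edges. -/
noncomputable def edgeProj {n : ℕ} (P : Polygon Plane n) (t : Plane → Plane) : Fin n → Plane :=
  fun i ↦ ⨍ x, t x ∂(edgeMeasure P i)

/-- The norm `‖·‖_{0,∂E}` of a vector field that equals the constant `c i` on the `i`-th edge. -/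
noncomputable def normBdry {n : ℕ} (P : Polygon Plane n) (c : Fin n → Plane) : ℝ :=
  √(∑ i, ∫ _x, ‖c i‖ ^ 2 ∂(edgeMeasure P i))

/-- `Δu = 0` in `E`, for `u ∈ H¹(E)`, in the sense of distributions. -/
def IsWeaklyHarmonic (E : Set Plane) (u : Plane → ℝ) : Prop :=
  ∀ φ : Plane → ℝ, IsTestFunction E φ → ∫ x in E, inner ℝ (weakGrad E u x) (∇ φ x) = 0

/-- The normal derivative `∂u/∂n` of a harmonic `u ∈ H¹(E)` equals the constant `c i` on the `i`-th
edge. The normal derivative is the functional `⟨∂u/∂n, φ⟩ = ∫_E ∇u · ∇φ + ∫_E Δu φ` in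
`H^{-1/2}(∂E)`, where `Δu = 0`; it is determined by its values on functions `φ` that are smooth up to
the boundary. -/
def HasNormalDeriv {n : ℕ} (P : Polygon Plane n) (E : Set Plane) (u : Plane → ℝ)
    (c : Fin n → ℝ) : Prop :=
  ∀ φ : Plane → ℝ, ContDiff ℝ ∞ φ →
    ∫ x in E, inner ℝ (weakGrad E u x) (∇ φ x) = ∑ i, ∫ x, c i * φ x ∂(edgeMeasure P i)

/-- The local nonconforming space `U_h^*(E)`: the fields `v ∈ H¹(E)²` with `Δv = 0` in `E` whose
normal derivative is constant on each edge. -/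
def nonconformingSpace {n : ℕ} (P : Polygon Plane n) (E : Set Plane) : Set (Plane → Plane) :=
  {v | ∀ k : Fin 2, MemH1 E (fun x ↦ v x k) ∧ IsWeaklyHarmonic E (fun x ↦ v x k) ∧
    ∃ c : Fin n → ℝ, HasNormalDeriv P E (fun x ↦ v x k) c}

end VEM

/-!
The argument is for one scalar component `u`, with weak gradient `∇u`, trace `t` and normal
derivative `c i` on the `i`-th edge. Write `h` for the diameter, `L i` for the edge lengths and
`a i` for the mean of `t` over the `i`-th edge.

*Dirichlet norm and edge means.* Since the normal derivative is constant on edges, Green's formula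
reads `‖∇u‖² = ∑ c i L i a i`. Testing the definition of the normal derivative with a cut-off
function that lives near the midpoint of an edge gives `|c i| ≤ C h⁻¹ ‖∇u‖`
(`exists_abs_normalDeriv_le`); here star-shapedness keeps the other edges away from the midpoint.
As the perimeter is at most `C h`, the two facts give `h ‖∇u‖² ≤ C ∑ L i (a i)²`
(`diam_mul_integral_weakGrad_le`).

*First estimate.* The sum on the right is at most the squared norm of the trace, which the
multiplicative trace inequality bounds by `C (h⁻¹ ‖u‖² + ‖u‖ ‖∇u‖)`. The result is a quadratic
inequality for `h ‖∇u‖` in terms of `‖u‖`.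

*Second estimate.* A Friedrichs inequality `‖u‖² ≤ C (h² ‖∇u‖² + h ∑ L i (a i)²)` (`friedrichs`)
leaves only the Dirichlet norm to be bounded, which has been done.

The uniform inequalities come from star-shapedness with respect to a ball. In the coordinates
`x₀ + s (y - x₀)`, `0 < s < 1`, `y ∈ ∂E`, the polygon minus its centre is a disjoint union of sectors
over the edges; this yields the divergence theorem for fields `G(x) (x - x₀)`
(`sum_cross_mul_integral`), hence the bounds on the perimeter and the trace inequality. The
Poincaré inequality (`poincare_ball`) is obtained by integrating the gradient along segments from
the ball. All of this is proved for functions smooth on the plane. It passes to `H¹(E)` because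
such functions are dense (`exists_smooth_approx`: contract towards the centre, then mollify), and
the trace inequality then also provides the trace (`exists_isTrace`).
-/

namespace VEM

/-! ### Star-shaped polygons -/

/-- `E` is the polygon bounded by `P`, and it is star-shaped with respect to every point of the open
ball of centre `x₀` and radius `ρ > 0`. -/
structure IsStarPolygon {n : ℕ} (P : Polygon Plane n) (E : Set Plane) (x₀ : Plane) (ρ : ℝ) :
    Prop where
  isPolygon : IsPolygon P E
  pos : 0 < ρ
  ball_subset : Metric.ball x₀ ρ ⊆ E
  star : ∀ y ∈ Metric.ball x₀ ρ, StarConvex ℝ y E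

/-- The determinant of two vectors of the plane. -/
def cross (p q : Plane) : ℝ := p 0 * q 1 - p 1 * q 0

lemma edgePath_apply {n : ℕ} (P : Polygon Plane n) (i : Fin n) (t : ℝ) :
    P.edgePath ℝ i t = P i + t • (P (finRotate n i) - P i) := by
  simp [Polygon.edgePath, AffineMap.lineMap_apply, add_comm]

lemma continuous_edgePath {n : ℕ} (P : Polygon Plane n) (i : Fin n) :
    Continuous (P.edgePath ℝ i) := by
  have : (P.edgePath ℝ i : ℝ → Plane) = fun t ↦ P i + t • (P (finRotate n i) - P i) :=
    funext (edgePath_apply P i)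
  rw [this]; fun_prop

lemma dist_eq_norm_edge {n : ℕ} (P : Polygon Plane n) (i : Fin n) :
    edgeLength P i = ‖P (finRotate n i) - P i‖ := by
  rw [edgeLength, dist_eq_norm, norm_sub_rev]

namespace IsPolygon

variable {n : ℕ} {P : Polygon Plane n} {E : Set Plane}

lemma edgePath_mem_frontier (h : IsPolygon P E) (i : Fin n) {t : ℝ} (ht : t ∈ Set.Icc (0 : ℝ) 1) :
    P.edgePath ℝ i t ∈ frontier E := by
  rw [h.frontier_eq, Polygon.boundary]
  exact Set.mem_iUnion.2 ⟨i, by rw [Polygon.edgeSet_eq_image_edgePath]; exact ⟨t, ht, rfl⟩⟩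

/-- The half-open edges cover the boundary, since each endpoint starts the next edge. -/
lemma exists_edgePath_eq (h : IsPolygon P E) {y : Plane} (hy : y ∈ frontier E) :
    ∃ i, ∃ t ∈ Set.Ico (0 : ℝ) 1, P.edgePath ℝ i t = y := by
  rw [h.frontier_eq, Polygon.boundary, Set.mem_iUnion] at hy
  obtain ⟨i, hi⟩ := hy
  rw [Polygon.edgeSet_eq_image_edgePath] at hi
  obtain ⟨t, ht, rfl⟩ := hi
  rcases ht.2.lt_or_eq with h1 | rfl
  · exact ⟨i, t, ⟨ht.1, h1⟩, rfl⟩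
  · exact ⟨finRotate n i, 0, by simp, by simp [edgePath_apply]⟩

lemma notMem_of_mem_frontier (h : IsPolygon P E) {y : Plane} (hy : y ∈ frontier E) : y ∉ E := by
  intro hE
  have := h.isOpen.inter_frontier_eq
  exact (Set.eq_empty_iff_forall_notMem.1 this) y ⟨hE, hy⟩

lemma edge_ne_zero (h : IsPolygon P E) (i : Fin n) : P (finRotate n i) - P i ≠ 0 := by
  intro h0
  have := (h.simple i i 0 (by simp) (1 / 2) (by norm_num)
    (by rw [edgePath_apply, edgePath_apply, h0]; simp)).2
  norm_num at this

lemma edgeLength_pos (h : IsPolygon P E) (i : Fin n) : 0 < edgeLength P i := by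
  rw [dist_eq_norm_edge]; exact norm_pos_iff.2 (h.edge_ne_zero i)

lemma norm_sub_le_diam (h : IsPolygon P E) {x y : Plane} (hx : x ∈ closure E)
    (hy : y ∈ closure E) : ‖x - y‖ ≤ Metric.diam E := by
  rw [← dist_eq_norm, ← Metric.diam_closure E]
  exact Metric.dist_le_diam_of_mem h.isBounded.closure hx hy

lemma vertex_mem_closure (h : IsPolygon P E) (i : Fin n) : P i ∈ closure E := by
  have := frontier_subset_closure (h.edgePath_mem_frontier i (t := 0) (by simp))
  simpa [edgePath_apply] using this

lemma edgeLength_le_diam (h : IsPolygon P E) (i : Fin n) : edgeLength P i ≤ Metric.diam E := by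
  rw [dist_eq_norm_edge]
  exact h.norm_sub_le_diam (h.vertex_mem_closure _) (h.vertex_mem_closure _)

end IsPolygon

namespace IsStarPolygon

variable {n : ℕ} {P : Polygon Plane n} {E : Set Plane} {x₀ : Plane} {ρ : ℝ}

lemma center_mem (h : IsStarPolygon P E x₀ ρ) : x₀ ∈ Metric.ball x₀ ρ :=
  Metric.mem_ball_self h.pos

/-- Rays from a point `z` of the ball to a point `y` of the closure stay in the open set `E` before
they reach `y`: moving `y` slightly into `E` can be compensated by moving `z` within the ball. -/
lemma add_smul_mem (h : IsStarPolygon P E x₀ ρ) {z y : Plane} (hz : z ∈ Metric.ball x₀ ρ)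
    (hy : y ∈ closure E) {s : ℝ} (hs0 : 0 ≤ s) (hs1 : s < 1) : z + s • (y - z) ∈ E := by
  have h1s : 0 < 1 - s := by linarith
  have hc : Continuous fun y' : Plane ↦ z + (s / (1 - s)) • (y - y') := by fun_prop
  have hcy : z + (s / (1 - s)) • (y - y) ∈ Metric.ball x₀ ρ := by simpa using hz
  have hev : ∀ᶠ y' in 𝓝 y, z + (s / (1 - s)) • (y - y') ∈ Metric.ball x₀ ρ :=
    hc.continuousAt.eventually_mem (Metric.isOpen_ball.mem_nhds hcy)
  obtain ⟨y', hy'2, hy'1⟩ := ((mem_closure_iff_frequently.1 hy).and_eventually hev).exists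
  have key : (1 - s) • (z + (s / (1 - s)) • (y - y')) + s • y' ∈ E :=
    h.star _ hy'1 hy'2 h1s.le hs0 (by ring)
  have he : z + s • (y - z) = (1 - s) • (z + (s / (1 - s)) • (y - y')) + s • y' := by
    ext k
    simp only [PiLp.add_apply, PiLp.smul_apply, PiLp.sub_apply, smul_eq_mul]
    field_simp
    ring
  rw [he]
  exact key

/-- A ray from a point of the ball meets the boundary at most once. -/
lemma eq_of_ray (h : IsStarPolygon P E x₀ ρ) {z y₁ y₂ : Plane} (hz : z ∈ Metric.ball x₀ ρ)
    (h1 : y₁ ∈ frontier E) (h2 : y₂ ∈ frontier E) {r : ℝ} (hr : 0 < r)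
    (hy : y₁ - z = r • (y₂ - z)) : y₁ = y₂ := by
  rcases lt_trichotomy r 1 with h' | h' | h'
  · have := h.add_smul_mem hz (frontier_subset_closure h2) hr.le h'
    rw [← hy, add_sub_cancel] at this
    exact (h.isPolygon.notMem_of_mem_frontier h1 this).elim
  · subst h'; simpa using hy
  · have h3 : y₂ - z = r⁻¹ • (y₁ - z) := by rw [hy, smul_smul, inv_mul_cancel₀ hr.ne', one_smul]
    have := h.add_smul_mem hz (frontier_subset_closure h1) (inv_nonneg.2 hr.le)
      (inv_lt_one_of_one_lt₀ h')
    rw [← h3, add_sub_cancel] at this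
    exact (h.isPolygon.notMem_of_mem_frontier h2 this).elim

/-- Every point of `E` is on the way from `z` to some boundary point. -/
lemma exists_frontier_ray (h : IsStarPolygon P E x₀ ρ) {z x : Plane} (hx : x ∈ E) (hxz : x ≠ z) :
    ∃ y ∈ frontier E, ∃ s ∈ Set.Ioo (0 : ℝ) 1, x = z + s • (y - z) := by
  have hd : 0 < ‖x - z‖ := norm_pos_iff.2 (sub_ne_zero.2 hxz)
  let f : ℝ → Plane := fun r ↦ z + r • (x - z)
  have hf : Continuous f := by fun_prop
  -- a parameter beyond `1 + diam E / ‖x - z‖` leaves the bounded set `E`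
  obtain ⟨R, hR1, hR⟩ : ∃ R : ℝ, 1 ≤ R ∧ f R ∉ E := by
    refine ⟨1 + (Metric.diam E + 1) / ‖x - z‖, ?_, ?_⟩
    · have : 0 ≤ Metric.diam E := Metric.diam_nonneg
      have : 0 ≤ (Metric.diam E + 1) / ‖x - z‖ := by positivity
      linarith
    · intro hmem
      have := h.isPolygon.norm_sub_le_diam (subset_closure hmem) (subset_closure hx)
      have he : f (1 + (Metric.diam E + 1) / ‖x - z‖) - x
          = ((Metric.diam E + 1) / ‖x - z‖) • (x - z) := by
        simp only [f]; module
      have h0 : 0 ≤ Metric.diam E := Metric.diam_nonneg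
      rw [he, norm_smul, Real.norm_of_nonneg (by positivity), div_mul_cancel₀ _ hd.ne'] at this
      linarith
  have hpre : IsPreconnected (f '' Set.Icc 1 R) := isPreconnected_Icc.image f hf.continuousOn
  have hne : (frontier E ∩ f '' Set.Icc 1 R).Nonempty := by
    by_contra hcon
    rw [Set.not_nonempty_iff_eq_empty] at hcon
    have h1 : f '' Set.Icc 1 R ⊆ E ∪ (closure E)ᶜ := by
      intro w hw
      by_cases hwE : w ∈ E
      · exact Or.inl hwE
      · refine Or.inr fun hc ↦ ?_
        have : w ∈ frontier E ∩ f '' Set.Icc 1 R :=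
          ⟨by rw [frontier, h.isPolygon.isOpen.interior_eq]; exact ⟨hc, hwE⟩, hw⟩
        simp [hcon] at this
    have h2 := hpre.subset_or_subset h.isPolygon.isOpen isClosed_closure.isOpen_compl
      (Set.disjoint_left.2 fun a ha hb ↦ hb (subset_closure ha)) h1
    rcases h2 with h2 | h2
    · exact hR (h2 ⟨R, ⟨hR1, le_rfl⟩, rfl⟩)
    · refine h2 ⟨1, ⟨le_rfl, hR1⟩, rfl⟩ (subset_closure ?_)
      simpa [f] using hx
  obtain ⟨_, hyf, r, hr, rfl⟩ := hne
  have hr1 : 1 < r := by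
    refine lt_of_le_of_ne hr.1 fun he ↦ ?_
    subst he
    exact h.isPolygon.notMem_of_mem_frontier hyf (by simpa [f] using hx)
  refine ⟨f r, hyf, r⁻¹, ⟨by positivity, inv_lt_one_of_one_lt₀ hr1⟩, ?_⟩
  simp only [f, add_sub_cancel_left, smul_smul]
  rw [inv_mul_cancel₀ (by linarith), one_smul, add_sub_cancel]

/-- No point of the ball is on the line through an edge: otherwise two boundary points of the edge
would lie on one ray from that point. -/
lemma cross_ne_zero (h : IsStarPolygon P E x₀ ρ) {z : Plane} (hz : z ∈ Metric.ball x₀ ρ)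
    (i : Fin n) : cross (P i - z) (P (finRotate n i) - P i) ≠ 0 := by
  intro h0
  set d := P (finRotate n i) - P i with hd
  have hd0 : d ≠ 0 := h.isPolygon.edge_ne_zero i
  have hdsq : d 0 ^ 2 + d 1 ^ 2 ≠ 0 := by
    intro h1
    apply hd0
    ext k; fin_cases k <;> simp <;> nlinarith [sq_nonneg (d 0), sq_nonneg (d 1)]
  obtain ⟨τ, hτ⟩ : ∃ τ : ℝ, P i - z = τ • d := by
    refine ⟨((P i - z) 0 * d 0 + (P i - z) 1 * d 1) / (d 0 ^ 2 + d 1 ^ 2), ?_⟩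
    unfold cross at h0
    ext k
    fin_cases k
    · simp only [Fin.zero_eta, PiLp.smul_apply, smul_eq_mul]
      field_simp
      linear_combination d 1 * h0
    · simp only [Fin.mk_one, PiLp.smul_apply, smul_eq_mul]
      field_simp
      linear_combination - d 0 * h0
  have hpt : ∀ t : ℝ, P.edgePath ℝ i t - z = (τ + t) • d := by
    intro t
    rw [edgePath_apply, ← hd, add_smul, ← hτ]; abel
  have hzE := h.ball_subset hz
  have hno : ¬ (-τ ∈ Set.Icc (0 : ℝ) 1) := by
    intro hmem
    have h1 := h.isPolygon.edgePath_mem_frontier i hmem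
    have h2 := hpt (-τ)
    rw [add_neg_cancel, zero_smul, sub_eq_zero] at h2
    rw [h2] at h1
    exact h.isPolygon.notMem_of_mem_frontier h1 hzE
  -- the points with parameters `0` and `1 / 2` are on the same side of `z`
  have hsign : 0 < (τ + 0) / (τ + 1 / 2) := by
    by_cases hτ0 : 0 < τ
    · exact div_pos (by linarith) (by linarith)
    · have : τ < -1 := by
        by_contra h1
        exact hno ⟨by linarith, by linarith⟩
      exact div_pos_of_neg_of_neg (by linarith) (by linarith)
  have hne : τ + 1 / 2 ≠ 0 := by
    intro h1; rw [h1] at hsign; simp at hsign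
  have heq := h.eq_of_ray hz (h.isPolygon.edgePath_mem_frontier i (t := 0) (by simp))
    (h.isPolygon.edgePath_mem_frontier i (t := 1 / 2) (by norm_num)) hsign (by
      rw [hpt, hpt, smul_smul, div_mul_cancel₀ _ hne])
  have := (h.isPolygon.simple i i 0 (by simp) (1 / 2) (by norm_num) heq).2
  norm_num at this

end IsStarPolygon

lemma norm_sq_plane (p : Plane) : ‖p‖ ^ 2 = p 0 ^ 2 + p 1 ^ 2 := by
  simp [EuclideanSpace.norm_sq_eq, Fin.sum_univ_two]

lemma abs_cross_le (p q : Plane) : |cross p q| ≤ ‖p‖ * ‖q‖ := by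
  apply abs_le_of_sq_le_sq _ (by positivity)
  rw [mul_pow, norm_sq_plane, norm_sq_plane, cross]
  nlinarith [sq_nonneg (p 0 * q 0 + p 1 * q 1)]

namespace IsStarPolygon

variable {n : ℕ} {P : Polygon Plane n} {E : Set Plane} {x₀ : Plane} {ρ : ℝ}

/-- The line through an edge has distance at least `ρ` from the centre of the ball. -/
lemma mul_edgeLength_le_abs_cross (h : IsStarPolygon P E x₀ ρ) (i : Fin n) :
    ρ * edgeLength P i ≤ |cross (P i - x₀) (P (finRotate n i) - P i)| := by
  by_contra! hlt
  rw [dist_eq_norm_edge] at hlt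
  set d := P (finRotate n i) - P i with hd
  have hd0 : 0 < ‖d‖ := norm_pos_iff.2 (h.isPolygon.edge_ne_zero i)
  set κ := cross (P i - x₀) d with hκ
  -- the foot of the perpendicular from the centre to the line
  let w : Plane := (κ / ‖d‖ ^ 2) • !₂[d 1, -d 0]
  have hw : ‖w‖ < ρ := by
    have h1 : ‖(!₂[d 1, -d 0] : Plane)‖ = ‖d‖ := by
      rw [← sq_eq_sq₀ (norm_nonneg _) (norm_nonneg _), norm_sq_plane, norm_sq_plane]
      simp; ring
    simp only [w]
    rw [norm_smul, h1, norm_div, Real.norm_eq_abs, norm_pow, norm_norm]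
    rw [div_mul_eq_mul_div, div_lt_iff₀ (by positivity)]
    nlinarith
  refine h.cross_ne_zero (z := x₀ + w) (by simpa using hw) i ?_
  rw [← hd]
  have hsq := norm_sq_plane d
  have h2 : cross (P i - (x₀ + w)) d = κ - κ / ‖d‖ ^ 2 * (d 0 ^ 2 + d 1 ^ 2) := by
    simp [hκ, cross, w]; ring
  rw [h2, ← hsq]
  field_simp
  ring

lemma abs_cross_le_diam_mul (h : IsStarPolygon P E x₀ ρ) (i : Fin n) :
    |cross (P i - x₀) (P (finRotate n i) - P i)| ≤ Metric.diam E * edgeLength P i := by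
  rw [dist_eq_norm_edge]
  refine (abs_cross_le _ _).trans ?_
  gcongr
  exact h.isPolygon.norm_sub_le_diam (h.isPolygon.vertex_mem_closure i)
    (subset_closure (h.ball_subset h.center_mem))

end IsStarPolygon

/-! ### Sector coordinates and the divergence theorem -/

/-- Sector coordinates: `(s, t) ↦ c + s (p + t d)` maps `(0,1) × [0,1)` onto the open triangle with
apex `c` and opposite side from `c + p` to `c + p + d`, together with one of its lateral sides. -/
def sectorMap (c p d : Plane) (q : ℝ × ℝ) : Plane := c + q.1 • (p + q.2 • d)

lemma continuous_sectorMap (c p d : Plane) : Continuous (sectorMap c p d) := by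
  unfold sectorMap; fun_prop

/-- Change of variables to sector coordinates, with Jacobian `s · cross p d`. -/
lemma setIntegral_sectorMap_image (c p d : Plane) (F : Plane → ℝ) {S : Set (ℝ × ℝ)}
    (hS : MeasurableSet S) (hinj : Set.InjOn (sectorMap c p d) S) :
    ∫ x in sectorMap c p d '' S, F x
      = ∫ q in S, |q.1 * cross p d| * F (sectorMap c p d q) := by
  let e : Plane ≃ᵐ ℝ × ℝ :=
    (MeasurableEquiv.toLp 2 (Fin 2 → ℝ)).symm.trans MeasurableEquiv.finTwoArrow
  have he : MeasurePreserving e volume volume :=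
    (EuclideanSpace.volume_preserving_symm_measurableEquiv_toLp (Fin 2)).trans
      (volume_preserving_finTwoArrow ℝ)
  have hex : ∀ x, e x = (x 0, x 1) := fun x ↦ rfl
  let T : ℝ × ℝ → ℝ × ℝ := fun q ↦ e (sectorMap c p d q)
  have hT : ∀ q, T q = (c 0 + q.1 * (p 0 + q.2 * d 0), c 1 + q.1 * (p 1 + q.2 * d 1)) := by
    intro q
    simp only [T, hex, sectorMap, PiLp.add_apply, PiLp.smul_apply, smul_eq_mul]
  have himg : sectorMap c p d '' S = e ⁻¹' (T '' S) := by
    ext x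
    constructor
    · rintro ⟨q, hq, rfl⟩; exact ⟨q, hq, rfl⟩
    · rintro ⟨q, hq, hqx⟩; exact ⟨q, hq, e.injective hqx⟩
  have h1 : ∫ x in sectorMap c p d '' S, F x = ∫ y in T '' S, F (e.symm y) := by
    rw [himg, ← he.setIntegral_preimage_emb e.measurableEmbedding]
    simp
  let T' : ℝ × ℝ → ℝ × ℝ →L[ℝ] ℝ × ℝ := fun q ↦
    (Matrix.toLin (.finTwoProd ℝ) (.finTwoProd ℝ)
      !![p 0 + q.2 * d 0, q.1 * d 0; p 1 + q.2 * d 1, q.1 * d 1]).toContinuousLinearMap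
  have hdet : ∀ q, (T' q).det = q.1 * cross p d := by
    intro q
    simp only [T', LinearMap.det_toContinuousLinearMap, LinearMap.det_toLin,
      Matrix.det_fin_two_of, cross]
    ring
  have hderiv : ∀ q ∈ S, HasFDerivWithinAt T (T' q) S q := by
    intro q _
    apply HasFDerivAt.hasFDerivWithinAt
    rw [show T = fun q ↦ (c 0 + q.1 * (p 0 + q.2 * d 0), c 1 + q.1 * (p 1 + q.2 * d 1)) from
      funext hT]
    simp only [T']
    rw [Matrix.toLin_finTwoProd_toContinuousLinearMap]
    have hfst : HasFDerivAt (fun q : ℝ × ℝ ↦ q.1) (ContinuousLinearMap.fst ℝ ℝ ℝ) q :=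
      hasFDerivAt_fst
    have hsnd : HasFDerivAt (fun q : ℝ × ℝ ↦ q.2) (ContinuousLinearMap.snd ℝ ℝ ℝ) q :=
      hasFDerivAt_snd
    have hcomp : ∀ k, HasFDerivAt (fun q : ℝ × ℝ ↦ c k + q.1 * (p k + q.2 * d k))
        ((p k + q.2 * d k) • ContinuousLinearMap.fst ℝ ℝ ℝ
          + (q.1 * d k) • ContinuousLinearMap.snd ℝ ℝ ℝ) q := by
      intro k
      refine ((hfst.mul ((hsnd.mul_const (d k)).const_add (p k))).const_add (c k)).congr_fderiv ?_
      ext <;> simp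
    exact (hcomp 0).prodMk (hcomp 1)
  have hTinj : Set.InjOn T S := fun a ha b hb hab ↦ hinj ha hb (e.injective hab)
  rw [h1, integral_image_eq_integral_abs_det_fderiv_smul volume hS hderiv hTinj]
  simp [hdet, T]

/-- Fundamental theorem of calculus along the ray from `c` to `c + v`, in polar form. -/
lemma integral_radial {G : Plane → ℝ} (hG : ContDiff ℝ 1 G) (c v : Plane) :
    ∫ s in Set.Ioo (0 : ℝ) 1,
      s * (2 * G (c + s • v) + inner ℝ (∇ G (c + s • v)) (s • v)) = G (c + v) := by
  rw [← integral_Ioc_eq_integral_Ioo, ← intervalIntegral.integral_of_le zero_le_one]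
  have hgrad : Continuous (fun x ↦ fderiv ℝ G x) := hG.continuous_fderiv one_ne_zero
  have hd : ∀ s : ℝ, HasDerivAt (fun s : ℝ ↦ s ^ 2 * G (c + s • v))
      (s * (2 * G (c + s • v) + inner ℝ (∇ G (c + s • v)) (s • v))) s := by
    intro s
    have h1 : HasDerivAt (fun s : ℝ ↦ c + s • v) v s := by
      simpa using ((hasDerivAt_id s).smul_const v).const_add c
    have h2 := ((hG.differentiable one_ne_zero (c + s • v)).hasFDerivAt).comp_hasDerivAt s h1
    refine ((hasDerivAt_pow 2 s).mul h2).congr_deriv ?_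
    rw [inner_smul_right, inner_gradient_left]
    simp only [Function.comp]
    push_cast
    ring
  rw [intervalIntegral.integral_eq_sub_of_hasDerivAt (fun s _ ↦ hd s)]
  · simp
  · apply Continuous.intervalIntegrable
    have hc := hG.continuous
    simp only [inner_gradient_left]
    fun_prop

/-- The sector over the `i`-th edge. -/
def sector {n : ℕ} (P : Polygon Plane n) (x₀ : Plane) (i : Fin n) : Set Plane :=
  sectorMap x₀ (P i - x₀) (P (finRotate n i) - P i) '' (Set.Ioo 0 1 ×ˢ Set.Ico 0 1)

lemma sectorMap_eq {n : ℕ} (P : Polygon Plane n) (x₀ : Plane) (i : Fin n) (q : ℝ × ℝ) :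
    sectorMap x₀ (P i - x₀) (P (finRotate n i) - P i) q
      = x₀ + q.1 • (P.edgePath ℝ i q.2 - x₀) := by
  rw [sectorMap, edgePath_apply]; congr 2; abel

namespace IsStarPolygon

variable {n : ℕ} {P : Polygon Plane n} {E : Set Plane} {x₀ : Plane} {ρ : ℝ}

/-- Sector coordinates determine the edge and the coordinates. -/
lemma sectorMap_inj (h : IsStarPolygon P E x₀ ρ) {i j : Fin n} {q r : ℝ × ℝ}
    (hq : q ∈ Set.Ioo (0 : ℝ) 1 ×ˢ Set.Ico (0 : ℝ) 1)
    (hr : r ∈ Set.Ioo (0 : ℝ) 1 ×ˢ Set.Ico (0 : ℝ) 1)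
    (heq : sectorMap x₀ (P i - x₀) (P (finRotate n i) - P i) q
      = sectorMap x₀ (P j - x₀) (P (finRotate n j) - P j) r) : i = j ∧ q = r := by
  rw [sectorMap_eq, sectorMap_eq, add_right_inj] at heq
  have hfi := h.isPolygon.edgePath_mem_frontier i (Set.Ico_subset_Icc_self hq.2)
  have hfj := h.isPolygon.edgePath_mem_frontier j (Set.Ico_subset_Icc_self hr.2)
  have h1 : P.edgePath ℝ i q.2 - x₀ = (q.1⁻¹ * r.1) • (P.edgePath ℝ j r.2 - x₀) := by
    rw [mul_smul, ← heq, smul_smul, inv_mul_cancel₀ hq.1.1.ne', one_smul]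
  have h2 := h.eq_of_ray h.center_mem hfi hfj (mul_pos (inv_pos.2 hq.1.1) hr.1.1) h1
  obtain ⟨hij, ht⟩ := h.isPolygon.simple i j _ hq.2 _ hr.2 h2
  refine ⟨hij, Prod.ext ?_ ht⟩
  rw [h2] at heq
  have hne : P.edgePath ℝ j r.2 - x₀ ≠ 0 := by
    intro h0
    rw [sub_eq_zero] at h0
    rw [h0] at hfj
    exact h.isPolygon.notMem_of_mem_frontier hfj (h.ball_subset h.center_mem)
  exact smul_left_injective ℝ hne heq

lemma iUnion_sector (h : IsStarPolygon P E x₀ ρ) : ⋃ i, sector P x₀ i = E \ {x₀} := by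
  ext x
  simp only [Set.mem_iUnion, sector, Set.mem_image, Set.mem_sdiff, Set.mem_singleton_iff]
  constructor
  · rintro ⟨i, q, hq, rfl⟩
    have hf := h.isPolygon.edgePath_mem_frontier i (Set.Ico_subset_Icc_self hq.2)
    rw [sectorMap_eq]
    refine ⟨h.add_smul_mem h.center_mem (frontier_subset_closure hf) hq.1.1.le hq.1.2, ?_⟩
    intro h0
    rw [add_eq_left, smul_eq_zero, sub_eq_zero] at h0
    rcases h0 with h0 | h0
    · exact hq.1.1.ne' h0
    · rw [h0] at hf
      exact h.isPolygon.notMem_of_mem_frontier hf (h.ball_subset h.center_mem)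
  · rintro ⟨hx, hne⟩
    obtain ⟨y, hy, s, hs, rfl⟩ := h.exists_frontier_ray hx hne
    obtain ⟨i, t, ht, rfl⟩ := h.isPolygon.exists_edgePath_eq hy
    exact ⟨i, (s, t), ⟨hs, ht⟩, sectorMap_eq P x₀ i (s, t)⟩

lemma setIntegral_eq_sum (h : IsStarPolygon P E x₀ ρ) {F : Plane → ℝ}
    (hF : IntegrableOn F E) :
    ∫ x in E, F x = ∑ i, |cross (P i - x₀) (P (finRotate n i) - P i)| *
      ∫ q in Set.Ioo (0 : ℝ) 1 ×ˢ Set.Ico (0 : ℝ) 1,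
        q.1 * F (x₀ + q.1 • (P.edgePath ℝ i q.2 - x₀)) := by
  have hS : MeasurableSet (Set.Ioo (0 : ℝ) 1 ×ˢ Set.Ico (0 : ℝ) 1) :=
    measurableSet_Ioo.prod measurableSet_Ico
  have hinj : ∀ i, Set.InjOn (sectorMap x₀ (P i - x₀) (P (finRotate n i) - P i))
      (Set.Ioo (0 : ℝ) 1 ×ˢ Set.Ico (0 : ℝ) 1) :=
    fun i q hq r hr heq ↦ (h.sectorMap_inj hq hr heq).2
  have hmeas : ∀ i, MeasurableSet (sector P x₀ i) := fun i ↦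
    hS.image_of_continuousOn_injOn (continuous_sectorMap _ _ _).continuousOn (hinj i)
  have hdisj : Pairwise (Function.onFun Disjoint (sector P x₀)) := by
    intro i j hij
    refine Set.disjoint_left.2 ?_
    rintro _ ⟨q, hq, rfl⟩ ⟨r, hr, heq⟩
    exact hij (h.sectorMap_inj hr hq heq).1.symm
  have hE : ∫ x in E, F x = ∫ x in ⋃ i, sector P x₀ i, F x := by
    rw [h.iUnion_sector]
    exact setIntegral_congr_set (sdiff_null_ae_eq_self (by simp)).symm
  rw [hE, integral_iUnion_fintype hmeas hdisj fun i ↦ hF.mono_set ?_]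
  · refine Finset.sum_congr rfl fun i _ ↦ ?_
    rw [sector, setIntegral_sectorMap_image _ _ _ _ hS (hinj i), ← integral_const_mul]
    refine setIntegral_congr_fun hS fun q hq ↦ ?_
    simp only [sectorMap_eq, abs_mul, abs_of_pos hq.1.1]
    ring
  · exact (Set.subset_iUnion _ i).trans (h.iUnion_sector.subset.trans Set.sdiff_subset)

/-- The divergence theorem for the field `G(x) (x - x₀)`: its flux through the `i`-th edge is the
integral of `G` over the edge times the distance from `x₀` to the line of the edge. -/
lemma sum_cross_mul_integral (h : IsStarPolygon P E x₀ ρ) {G : Plane → ℝ}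
    (hG : ContDiff ℝ 1 G) :
    ∑ i, |cross (P i - x₀) (P (finRotate n i) - P i)| *
        ∫ t in Set.Ico (0 : ℝ) 1, G (P.edgePath ℝ i t)
      = ∫ x in E, (2 * G x + inner ℝ (∇ G x) (x - x₀)) := by
  have hgrad : Continuous (fun x ↦ fderiv ℝ G x) := hG.continuous_fderiv one_ne_zero
  have hGc := hG.continuous
  have hc : Continuous fun x ↦ 2 * G x + inner ℝ (∇ G x) (x - x₀) := by
    simp only [inner_gradient_left]; fun_prop
  have hint : IntegrableOn (fun x ↦ 2 * G x + inner ℝ (∇ G x) (x - x₀)) E :=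
    (hc.continuousOn.integrableOn_compact h.isPolygon.isBounded.isCompact_closure).mono_set
      subset_closure
  rw [h.setIntegral_eq_sum hint]
  refine Finset.sum_congr rfl fun i _ ↦ ?_
  congr 1
  have hep := continuous_edgePath P i
  set f : ℝ × ℝ → ℝ := fun q ↦ q.1 * (2 * G (x₀ + q.1 • (P.edgePath ℝ i q.2 - x₀)) +
    inner ℝ (∇ G (x₀ + q.1 • (P.edgePath ℝ i q.2 - x₀)))
      (x₀ + q.1 • (P.edgePath ℝ i q.2 - x₀) - x₀)) with hf
  have hfc : Continuous f := by
    simp only [hf, inner_gradient_left]; fun_prop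
  have hfi : IntegrableOn (fun q : ℝ × ℝ ↦ f q.swap) (Set.Ico (0 : ℝ) 1 ×ˢ Set.Ioo (0 : ℝ) 1)
      (volume.prod volume) :=
    ((hfc.comp continuous_swap).continuousOn.integrableOn_compact
      (isCompact_Icc.prod isCompact_Icc)).mono_set
      (Set.prod_mono Set.Ico_subset_Icc_self Set.Ioo_subset_Icc_self)
  have h1 : ∫ q in Set.Ioo (0 : ℝ) 1 ×ˢ Set.Ico (0 : ℝ) 1, f q
      = ∫ t in Set.Ico (0 : ℝ) 1, ∫ s in Set.Ioo (0 : ℝ) 1, f (s, t) := by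
    rw [Measure.volume_eq_prod, ← setIntegral_prod_swap, setIntegral_prod _ hfi]
    rfl
  rw [h1]
  refine setIntegral_congr_fun measurableSet_Ico fun t _ ↦ ?_
  have := integral_radial hG x₀ (P.edgePath ℝ i t - x₀)
  simp only [hf, add_sub_cancel_left]
  rw [this, add_sub_cancel]

end IsStarPolygon

/-! ### Arc length measure and the trace inequality -/

lemma integral_norm_mul_norm_le {α V W : Type*} [MeasurableSpace α] {μ : Measure α}
    [NormedAddCommGroup V] [NormedAddCommGroup W] {f : α → V} {g : α → W} (hf : MemLp f 2 μ)
    (hg : MemLp g 2 μ) :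
    ∫ x, ‖f x‖ * ‖g x‖ ∂μ ≤ √(∫ x, ‖f x‖ ^ 2 ∂μ) * √(∫ x, ‖g x‖ ^ 2 ∂μ) := by
  have hpq : (2 : ℝ).HolderConjugate 2 := Real.HolderConjugate.two_two
  have h := integral_mul_le_Lp_mul_Lq_of_nonneg hpq (μ := μ) (f := fun x ↦ ‖f x‖)
    (g := fun x ↦ ‖g x‖) (ae_of_all _ fun _ ↦ norm_nonneg _) (ae_of_all _ fun _ ↦ norm_nonneg _)
    (by simpa using hf.norm) (by simpa using hg.norm)
  simpa [Real.sqrt_eq_rpow] using h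

lemma abs_integral_inner_le {α V : Type*} [MeasurableSpace α] {μ : Measure α}
    [NormedAddCommGroup V] [InnerProductSpace ℝ V] {f g : α → V} (hf : MemLp f 2 μ)
    (hg : MemLp g 2 μ) :
    |∫ x, inner ℝ (f x) (g x) ∂μ| ≤ √(∫ x, ‖f x‖ ^ 2 ∂μ) * √(∫ x, ‖g x‖ ^ 2 ∂μ) := by
  refine le_trans ?_ (integral_norm_mul_norm_le hf hg)
  refine abs_integral_le_integral_abs.trans ?_
  refine integral_mono_of_nonneg (ae_of_all _ fun _ ↦ abs_nonneg _) ?_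
    (ae_of_all _ fun x ↦ abs_real_inner_le_norm _ _)
  exact hf.norm.integrable_mul hg.norm

lemma gradient_continuous {φ : Plane → ℝ} (hφ : ContDiff ℝ 1 φ) : Continuous (∇ φ) := by
  have := hφ.continuous_fderiv one_ne_zero
  unfold gradient
  fun_prop

lemma gradient_sub_const (φ : Plane → ℝ) (c : ℝ) (x : Plane) :
    ∇ (fun y ↦ φ y - c) x = ∇ φ x := by
  simp [gradient, fderiv_sub_const]

section EdgeMeasure

variable {n : ℕ} (P : Polygon Plane n)

instance isFiniteMeasure_edgeMeasure (i : Fin n) : IsFiniteMeasure (edgeMeasure P i) := by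
  unfold edgeMeasure
  exact Measure.smul_finite _ ENNReal.ofReal_ne_top

instance isFiniteMeasure_boundaryMeasure : IsFiniteMeasure (boundaryMeasure P) := by
  unfold boundaryMeasure; infer_instance

lemma edgeMeasure_le_boundaryMeasure (i : Fin n) : edgeMeasure P i ≤ boundaryMeasure P :=
  Measure.le_iff'.2 fun s ↦ by
    rw [boundaryMeasure, Measure.finsetSum_apply]
    exact Finset.single_le_sum (f := fun j ↦ edgeMeasure P j s) (fun _ _ ↦ zero_le)
      (Finset.mem_univ i)

lemma integral_edgeMeasure {f : Plane → ℝ} (hf : Continuous f) (i : Fin n) :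
    ∫ x, f x ∂(edgeMeasure P i)
      = edgeLength P i * ∫ t in Set.Ico (0 : ℝ) 1, f (P.edgePath ℝ i t) := by
  rw [edgeMeasure, integral_smul_measure, integral_map (continuous_edgePath P i).aemeasurable
    hf.aestronglyMeasurable, ENNReal.toReal_ofReal (show 0 ≤ edgeLength P i from dist_nonneg),
    smul_eq_mul,
    integral_Icc_eq_integral_Ico]

lemma edgeMeasure_real_univ (i : Fin n) : (edgeMeasure P i).real Set.univ = edgeLength P i := by
  have := integral_edgeMeasure P (f := fun _ ↦ 1) continuous_const i
  simpa using this

lemma integrable_edgeMeasure {f : Plane → ℝ} (hf : Continuous f) (i : Fin n) :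
    Integrable f (edgeMeasure P i) := by
  have hp := continuous_edgePath P i
  refine Integrable.smul_measure ?_ ENNReal.ofReal_ne_top
  rw [integrable_map_measure hf.aestronglyMeasurable hp.aemeasurable]
  exact (hf.comp hp).continuousOn.integrableOn_compact isCompact_Icc

lemma integral_boundaryMeasure {f : Plane → ℝ} (hf : ∀ i, Integrable f (edgeMeasure P i)) :
    ∫ x, f x ∂(boundaryMeasure P) = ∑ i, ∫ x, f x ∂(edgeMeasure P i) :=
  integral_finsetSum_measure fun i _ ↦ hf i

lemma memLp_boundaryMeasure {f : Plane → ℝ} (hf : Continuous f) :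
    MemLp f 2 (boundaryMeasure P) := by
  rw [memLp_two_iff_integrable_sq hf.aestronglyMeasurable]
  exact integrable_finsetSum_measure.2 fun i _ ↦ integrable_edgeMeasure P (hf.pow 2) i

end EdgeMeasure

namespace IsPolygon

variable {n : ℕ} {P : Polygon Plane n} {E : Set Plane}

lemma isFiniteMeasure_restrict (h : IsPolygon P E) : IsFiniteMeasure (volume.restrict E) :=
  MeasureTheory.isFiniteMeasure_restrict.2 h.isBounded.measure_lt_top.ne

lemma integrableOn (h : IsPolygon P E) {V : Type*} [NormedAddCommGroup V] {f : Plane → V}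
    (hf : Continuous f) : IntegrableOn f E :=
  (hf.continuousOn.integrableOn_compact h.isBounded.isCompact_closure).mono_set subset_closure

lemma memLp (h : IsPolygon P E) {V : Type*} [NormedAddCommGroup V]
    [SecondCountableTopology V] {f : Plane → V}
    (hf : Continuous f) : MemLp f 2 (volume.restrict E) := by
  rw [memLp_two_iff_integrable_sq_norm hf.aestronglyMeasurable]
  exact h.integrableOn (hf.norm.pow 2)

lemma diam_pos (h : IsPolygon P E) : 0 < Metric.diam E := by
  refine lt_of_le_of_ne Metric.diam_nonneg fun h0 ↦ ?_
  obtain ⟨x, hx⟩ := h.isConnected.nonempty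
  obtain ⟨r, hr, hsub⟩ := Metric.isOpen_iff.1 h.isOpen x hx
  obtain ⟨v, hv⟩ := exists_ne (0 : Plane)
  have hv' : 0 < ‖v‖ := norm_pos_iff.2 hv
  have hy : x + (r / 2 / ‖v‖) • v ∈ E := by
    apply hsub
    rw [mem_ball_iff_norm, add_sub_cancel_left, norm_smul, Real.norm_of_nonneg (by positivity),
      div_mul_cancel₀ _ hv'.ne']
    linarith
  have := h.norm_sub_le_diam (subset_closure hy) (subset_closure hx)
  rw [add_sub_cancel_left, norm_smul, Real.norm_of_nonneg (by positivity),
    div_mul_cancel₀ _ hv'.ne', ← h0] at this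
  linarith

lemma area_le (h : IsPolygon P E) : volume.real E ≤ Real.pi * Metric.diam E ^ 2 := by
  obtain ⟨x, hx⟩ := h.isConnected.nonempty
  have hsub : E ⊆ Metric.closedBall x (Metric.diam E) := fun y hy ↦
    Metric.dist_le_diam_of_mem h.isBounded hy hx
  have h1 := measureReal_mono (μ := volume) hsub Metric.isBounded_closedBall.measure_lt_top.ne
  refine h1.trans (le_of_eq ?_)
  rw [measureReal_def, EuclideanSpace.volume_closedBall_fin_two, ENNReal.toReal_mul,
    ENNReal.toReal_pow, ENNReal.toReal_ofReal Metric.diam_nonneg, mul_comm,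
    ENNReal.toReal_ofReal Real.pi_pos.le]

end IsPolygon

namespace IsStarPolygon

variable {n : ℕ} {P : Polygon Plane n} {E : Set Plane} {x₀ : Plane} {ρ : ℝ}

/-- The divergence theorem with `G = 1`: each sector has area half its determinant. -/
lemma two_mul_area (h : IsStarPolygon P E x₀ ρ) :
    ∑ i, |cross (P i - x₀) (P (finRotate n i) - P i)| = 2 * volume.real E := by
  have := h.sum_cross_mul_integral (G := fun _ ↦ 1) contDiff_const
  simpa [gradient_fun_const, mul_comm] using this

lemma mul_perimeter_le (h : IsStarPolygon P E x₀ ρ) :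
    ρ * ∑ i, edgeLength P i ≤ 2 * volume.real E := by
  rw [← h.two_mul_area, Finset.mul_sum]
  exact Finset.sum_le_sum fun i _ ↦ h.mul_edgeLength_le_abs_cross i

lemma two_mul_area_le (h : IsStarPolygon P E x₀ ρ) :
    2 * volume.real E ≤ Metric.diam E * ∑ i, edgeLength P i := by
  rw [← h.two_mul_area, Finset.mul_sum]
  exact Finset.sum_le_sum fun i _ ↦ h.abs_cross_le_diam_mul i

/-- The multiplicative trace inequality for functions smooth up to the boundary. It is the
divergence theorem for the field `φ² (x - x₀)`, whose normal component on the boundary is at least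
`ρ φ²`. -/
lemma trace_inequality (h : IsStarPolygon P E x₀ ρ) {φ : Plane → ℝ} (hφ : ContDiff ℝ 1 φ) :
    ρ * ∑ i, ∫ x, φ x ^ 2 ∂(edgeMeasure P i) ≤ 2 * (∫ x in E, φ x ^ 2) +
      2 * Metric.diam E * (√(∫ x in E, φ x ^ 2) * √(∫ x in E, ‖∇ φ x‖ ^ 2)) := by
  have hg := gradient_continuous hφ
  have hc := hφ.continuous
  have hE := h.isPolygon
  have hcs := integral_norm_mul_norm_le (hE.memLp hc) (hE.memLp hg)
  simp only [Real.norm_eq_abs, sq_abs] at hcs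
  have hgr : ∀ x, inner ℝ (∇ (fun y ↦ φ y ^ 2) x) (x - x₀)
      = 2 * φ x * inner ℝ (∇ φ x) (x - x₀) := by
    intro x
    rw [inner_gradient_left, inner_gradient_left]
    have := ((hφ.differentiable one_ne_zero x).hasFDerivAt.pow 2).fderiv
    rw [this]
    simp
  calc ρ * ∑ i, ∫ x, φ x ^ 2 ∂(edgeMeasure P i)
      ≤ ∑ i, |cross (P i - x₀) (P (finRotate n i) - P i)| *
        ∫ t in Set.Ico (0 : ℝ) 1, φ (P.edgePath ℝ i t) ^ 2 := by
        rw [Finset.mul_sum]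
        refine Finset.sum_le_sum fun i _ ↦ ?_
        rw [integral_edgeMeasure P (f := fun x ↦ φ x ^ 2) (hc.pow 2), ← mul_assoc]
        exact mul_le_mul_of_nonneg_right (h.mul_edgeLength_le_abs_cross i)
          (integral_nonneg fun _ ↦ sq_nonneg _)
    _ = ∫ x in E, (2 * φ x ^ 2 + 2 * φ x * inner ℝ (∇ φ x) (x - x₀)) := by
        rw [h.sum_cross_mul_integral (G := fun y ↦ φ y ^ 2) (hφ.pow 2)]
        simp only [hgr]
    _ ≤ ∫ x in E, (2 * φ x ^ 2 + 2 * Metric.diam E * (|φ x| * ‖∇ φ x‖)) := by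
        refine setIntegral_mono_on (hE.integrableOn (by fun_prop)) (hE.integrableOn (by fun_prop))
          hE.isOpen.measurableSet fun x hx ↦ ?_
        have h1 := real_inner_le_norm (φ x • ∇ φ x) (x - x₀)
        have h2 := hE.norm_sub_le_diam (subset_closure hx)
          (subset_closure (h.ball_subset h.center_mem))
        have h3 := mul_le_mul_of_nonneg_left h2 (norm_nonneg (φ x • ∇ φ x))
        rw [norm_smul, Real.norm_eq_abs] at h1 h3
        rw [real_inner_smul_left] at h1
        nlinarith
    _ ≤ _ := by
        rw [integral_add (hE.integrableOn (by fun_prop)) (hE.integrableOn (by fun_prop)),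
          integral_const_mul, integral_const_mul]
        have h1 := mul_le_mul_of_nonneg_left hcs
          (mul_nonneg zero_le_two (Metric.diam_nonneg (s := E)))
        linarith

end IsStarPolygon

/-! ### The Poincaré inequality -/

/-- The Cauchy–Schwarz inequality against the constant `1`. -/
lemma sq_integral_le {α : Type*} [MeasurableSpace α] {μ : Measure α} [IsFiniteMeasure μ]
    {f : α → ℝ} (hf : MemLp f 2 μ) : (∫ x, f x ∂μ) ^ 2 ≤ μ.real Set.univ * ∫ x, f x ^ 2 ∂μ := by
  have h := abs_integral_inner_le hf (memLp_const (1 : ℝ))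
  simp only [RCLike.inner_apply, conj_trivial, Real.norm_eq_abs, sq_abs, one_mul, integral_const,
    one_pow, smul_eq_mul, mul_one] at h
  have h2 := pow_le_pow_left₀ (abs_nonneg _) h 2
  rw [sq_abs, mul_pow, Real.sq_sqrt (integral_nonneg fun _ ↦ sq_nonneg _),
    Real.sq_sqrt measureReal_nonneg] at h2
  linarith

lemma measurableEmbedding_add_smul (a : Plane) {r : ℝ} (hr : r ≠ 0) :
    MeasurableEmbedding fun x : Plane ↦ a + r • x :=
  ((Homeomorph.smulOfNeZero r hr).trans (Homeomorph.addLeft a)).measurableEmbedding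

lemma map_add_smul (a : Plane) {r : ℝ} (hr : r ≠ 0) :
    Measure.map (fun x : Plane ↦ a + r • x) volume = ENNReal.ofReal ((r ^ 2)⁻¹) • volume := by
  have h := Measure.map_addHaar_smul (volume : Measure Plane) hr
  rw [finrank_euclideanSpace_fin, abs_of_nonneg (by positivity)] at h
  have h2 : Measure.map (fun x : Plane ↦ a + r • x) volume
      = Measure.map (fun x ↦ a + x) (Measure.map (fun x : Plane ↦ r • x) volume) := by
    rw [Measure.map_map (by fun_prop) (by fun_prop)]; rfl
  rw [h2, h, Measure.map_smul, map_add_left_eq_self]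

lemma lintegral_comp_add_smul (G : Plane → ENNReal) (a : Plane) {r : ℝ} (hr : r ≠ 0) :
    ∫⁻ x, G (a + r • x) = ENNReal.ofReal ((r ^ 2)⁻¹) * ∫⁻ x, G x := by
  rw [← (measurableEmbedding_add_smul a hr).lintegral_map, map_add_smul a hr,
    lintegral_smul_measure, smul_eq_mul]

lemma setLIntegral_comp_add_smul_le (G : Plane → ENNReal) (S : Set Plane) (a : Plane) {r : ℝ}
    (hr : 1 / 2 ≤ r) : ∫⁻ x in S, G (a + r • x) ≤ 4 * ∫⁻ x, G x := by
  refine (setLIntegral_le_lintegral _ _).trans ?_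
  rw [lintegral_comp_add_smul G a (by linarith)]
  gcongr
  rw [show (4 : ENNReal) = ENNReal.ofReal 4 by simp]
  refine ENNReal.ofReal_le_ofReal ?_
  rw [show (4 : ℝ) = ((1 / 2) ^ 2)⁻¹ by norm_num]
  gcongr

lemma sq_sub_le_integral_segment {φ : Plane → ℝ} (hφ : ContDiff ℝ 1 φ) (x z : Plane) :
    (φ x - φ z) ^ 2 ≤ ‖x - z‖ ^ 2 * ∫ r in Set.Ioc (0 : ℝ) 1, ‖∇ φ (z + r • (x - z))‖ ^ 2 := by
  have hg := gradient_continuous hφ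
  set f : ℝ → ℝ := fun r ↦ inner ℝ (∇ φ (z + r • (x - z))) (x - z) with hf
  have hfc : Continuous f := by fun_prop
  have hd : ∀ r : ℝ, HasDerivAt (fun r : ℝ ↦ φ (z + r • (x - z))) (f r) r := by
    intro r
    have h1 : HasDerivAt (fun r : ℝ ↦ z + r • (x - z)) (x - z) r := by
      simpa using ((hasDerivAt_id r).smul_const (x - z)).const_add z
    have h2 := ((hφ.differentiable one_ne_zero (z + r • (x - z))).hasFDerivAt).comp_hasDerivAt r h1
    refine h2.congr_deriv ?_
    exact inner_gradient_left.symm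
  have hi : φ x - φ z = ∫ r in Set.Ioc (0 : ℝ) 1, f r := by
    rw [← intervalIntegral.integral_of_le zero_le_one,
      intervalIntegral.integral_eq_sub_of_hasDerivAt (fun r _ ↦ hd r) (hfc.intervalIntegrable _ _)]
    simp
  have hon : ∀ F : ℝ → ℝ, Continuous F → IntegrableOn F (Set.Ioc (0 : ℝ) 1) := fun F hF ↦
    (hF.continuousOn.integrableOn_compact isCompact_Icc).mono_set Set.Ioc_subset_Icc_self
  have hfL : MemLp f 2 (volume.restrict (Set.Ioc (0 : ℝ) 1)) := by
    rw [memLp_two_iff_integrable_sq hfc.aestronglyMeasurable]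
    exact hon _ (hfc.pow 2)
  have h := sq_integral_le hfL
  rw [hi]
  refine h.trans ?_
  simp only [measureReal_restrict_apply_univ, Real.volume_real_Ioc, sub_zero, zero_le_one,
    sup_of_le_left, one_mul]
  rw [← integral_const_mul]
  refine setIntegral_mono_on (hon _ (hfc.pow 2)) (hon _ (by fun_prop)) measurableSet_Ioc
    fun r _ ↦ ?_
  rw [← mul_pow, mul_comm, ← sq_abs]
  exact pow_le_pow_left₀ (abs_nonneg _) (abs_real_inner_le_norm _ _) 2

namespace IsStarPolygon

variable {n : ℕ} {P : Polygon Plane n} {E : Set Plane} {x₀ : Plane} {ρ : ℝ}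

/-- The difference of `φ` at a point `x` of `E` and a point `z` of the ball is the integral of the
gradient along the segment between them, which is in `E`. The change of variables that removes the
segment parameter `r` is made in `x` where `r ≥ 1/2` and in `z` where `r ≤ 1/2`, so that the
Jacobian is at most `4`. -/
lemma lintegral_lintegral_sq_sub_le (h : IsStarPolygon P E x₀ ρ) {φ : Plane → ℝ}
    (hφ : ContDiff ℝ 1 φ) :
    ∫⁻ x in E, ∫⁻ z in Metric.ball x₀ ρ, ENNReal.ofReal ((φ x - φ z) ^ 2)
      ≤ ENNReal.ofReal (Metric.diam E ^ 2) *
        (4 * (volume (Metric.ball x₀ ρ) + volume E) *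
          ∫⁻ x in E, ENNReal.ofReal (‖∇ φ x‖ ^ 2)) := by
  have hg := gradient_continuous hφ
  have hEm := h.isPolygon.isOpen.measurableSet
  set B := Metric.ball x₀ ρ
  have hBm : MeasurableSet B := measurableSet_ball
  set G : Plane → ENNReal := E.indicator fun x ↦ ENNReal.ofReal (‖∇ φ x‖ ^ 2) with hG
  have hGm : Measurable G :=
    (ENNReal.measurable_ofReal.comp (hg.norm.pow 2).measurable).indicator hEm
  have hK : ∫⁻ x in E, ENNReal.ofReal (‖∇ φ x‖ ^ 2) = ∫⁻ x, G x := by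
    rw [hG, lintegral_indicator hEm]
  rw [hK]
  set K := ∫⁻ x, G x
  set I₁ := Set.Ioc (0 : ℝ) (1 / 2)
  set I₂ := Set.Ioc (1 / 2 : ℝ) 1
  let F₁ : Plane → Plane → ENNReal := fun x z ↦ ∫⁻ r in I₁, G (z + r • (x - z))
  let F₂ : Plane → Plane → ENNReal := fun x z ↦ ∫⁻ r in I₂, G (z + r • (x - z))
  have hm : Measurable fun p : (Plane × Plane) × ℝ ↦ G (p.1.2 + p.2 • (p.1.1 - p.1.2)) :=
    hGm.comp (by fun_prop)
  have hF₂ : Measurable (Function.uncurry F₂) := hm.lintegral_prod_right'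
  have hF₁ : Measurable (Function.uncurry F₁) := hm.lintegral_prod_right'
  have hpt : ∀ x ∈ E, ∀ z ∈ B, ENNReal.ofReal ((φ x - φ z) ^ 2)
      ≤ ENNReal.ofReal (Metric.diam E ^ 2) * (F₁ x z + F₂ x z) := by
    intro x hx z hz
    have hsum : F₁ x z + F₂ x z = ∫⁻ r in Set.Ioc (0 : ℝ) 1, G (z + r • (x - z)) := by
      rw [← Set.Ioc_union_Ioc_eq_Ioc (show (0 : ℝ) ≤ 1 / 2 by norm_num)
        (show (1 / 2 : ℝ) ≤ 1 by norm_num), lintegral_union measurableSet_Ioc]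
      exact Set.Ioc_disjoint_Ioc_of_le le_rfl
    have hval : ∫⁻ r in Set.Ioc (0 : ℝ) 1, G (z + r • (x - z))
        = ENNReal.ofReal (∫ r in Set.Ioc (0 : ℝ) 1, ‖∇ φ (z + r • (x - z))‖ ^ 2) := by
      have hc : Continuous fun r : ℝ ↦ ‖∇ φ (z + r • (x - z))‖ ^ 2 := by fun_prop
      rw [ofReal_integral_eq_lintegral_ofReal
        ((hc.continuousOn.integrableOn_compact isCompact_Icc).mono_set Set.Ioc_subset_Icc_self)
        (ae_of_all _ fun _ ↦ sq_nonneg _)]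
      refine setLIntegral_congr_fun measurableSet_Ioc fun r hr ↦ ?_
      have hmem : z + r • (x - z) ∈ E := by
        have := h.star z hz hx (show 0 ≤ 1 - r by linarith [hr.2]) hr.1.le (by ring)
        convert this using 1
        module
      simp only [hG, Set.indicator_of_mem hmem]
    rw [hsum, hval, ← ENNReal.ofReal_mul (sq_nonneg _)]
    refine ENNReal.ofReal_le_ofReal ((sq_sub_le_integral_segment hφ x z).trans ?_)
    have := h.isPolygon.norm_sub_le_diam (subset_closure hx) (subset_closure (h.ball_subset hz))
    gcongr
  have hlen₁ : volume I₁ ≤ 1 := by simp [I₁]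
  have hlen₂ : volume I₂ ≤ 1 := by simp only [I₂, Real.volume_Ioc]; norm_num
  have h₁ : ∀ x, ∫⁻ z in B, F₁ x z ≤ 4 * K := by
    intro x
    have hmx : Measurable fun p : Plane × ℝ ↦ G (p.1 + p.2 • (x - p.1)) := hGm.comp (by fun_prop)
    rw [lintegral_lintegral_swap hmx.aemeasurable]
    calc ∫⁻ r in I₁, ∫⁻ z in B, G (z + r • (x - z)) ≤ ∫⁻ _r in I₁, 4 * K := by
          refine setLIntegral_mono' measurableSet_Ioc fun r hr ↦ ?_
          have := setLIntegral_comp_add_smul_le G B (r • x) (r := 1 - r) (by linarith [hr.2])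
          refine le_trans (le_of_eq ?_) this
          refine lintegral_congr fun z ↦ ?_
          congr 1; module
      _ ≤ 4 * K := by
          rw [setLIntegral_const]
          exact mul_le_of_le_one_right' hlen₁
  have h₂ : ∀ z, ∫⁻ x in E, F₂ x z ≤ 4 * K := by
    intro z
    have hmx : Measurable fun p : Plane × ℝ ↦ G (z + p.2 • (p.1 - z)) := hGm.comp (by fun_prop)
    rw [lintegral_lintegral_swap hmx.aemeasurable]
    calc ∫⁻ r in I₂, ∫⁻ x in E, G (z + r • (x - z)) ≤ ∫⁻ _r in I₂, 4 * K := by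
          refine setLIntegral_mono' measurableSet_Ioc fun r hr ↦ ?_
          have := setLIntegral_comp_add_smul_le G E ((1 - r) • z) (r := r) hr.1.le
          refine le_trans (le_of_eq ?_) this
          refine lintegral_congr fun x ↦ ?_
          congr 1; module
      _ ≤ 4 * K := by
          rw [setLIntegral_const]
          exact mul_le_of_le_one_right' hlen₂
  calc ∫⁻ x in E, ∫⁻ z in B, ENNReal.ofReal ((φ x - φ z) ^ 2)
      ≤ ∫⁻ x in E, ∫⁻ z in B, ENNReal.ofReal (Metric.diam E ^ 2) * (F₁ x z + F₂ x z) :=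
        setLIntegral_mono' hEm fun x hx ↦ setLIntegral_mono' hBm fun z hz ↦ hpt x hx z hz
    _ = ENNReal.ofReal (Metric.diam E ^ 2) *
        ((∫⁻ x in E, ∫⁻ z in B, F₁ x z) + ∫⁻ x in E, ∫⁻ z in B, F₂ x z) := by
        have hm1 : ∀ x, Measurable (F₁ x) := fun x ↦ hF₁.comp measurable_prodMk_left
        have hm3 : Measurable fun x ↦ ∫⁻ z in B, F₁ x z := hF₁.lintegral_prod_right'
        rw [← lintegral_add_left hm3, ← lintegral_const_mul' _ _ ENNReal.ofReal_ne_top]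
        refine lintegral_congr fun x ↦ ?_
        rw [lintegral_const_mul' _ _ ENNReal.ofReal_ne_top, lintegral_add_left (hm1 x)]
    _ ≤ ENNReal.ofReal (Metric.diam E ^ 2) * (4 * K * volume E + 4 * K * volume B) := by
        gcongr
        · refine (lintegral_mono fun x ↦ h₁ x).trans ?_
          rw [setLIntegral_const]
        · rw [lintegral_lintegral_swap hF₂.aemeasurable]
          refine (lintegral_mono fun z ↦ h₂ z).trans ?_
          rw [setLIntegral_const]
    _ = _ := by ring

/-- The Poincaré inequality, with the mean value over the ball. -/
lemma poincare_ball (h : IsStarPolygon P E x₀ ρ) {φ : Plane → ℝ} (hφ : ContDiff ℝ 1 φ) :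
    ∃ m : ℝ, volume.real (Metric.ball x₀ ρ) * ∫ x in E, (φ x - m) ^ 2 ≤
      4 * Metric.diam E ^ 2 * (volume.real (Metric.ball x₀ ρ) + volume.real E) *
        ∫ x in E, ‖∇ φ x‖ ^ 2 := by
  have hg := gradient_continuous hφ
  have hc := hφ.continuous
  have hE := h.isPolygon
  set B := Metric.ball x₀ ρ with hB
  have hBfin : volume B ≠ ⊤ := measure_ball_lt_top.ne
  have hEfin : volume E ≠ ⊤ := hE.isBounded.measure_lt_top.ne
  have hBpos : 0 < volume.real B :=
    ENNReal.toReal_pos (Metric.measure_ball_pos _ _ h.pos).ne' hBfin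
  have : IsFiniteMeasure (volume.restrict B) := isFiniteMeasure_restrict.2 hBfin
  have hon : ∀ F : Plane → ℝ, Continuous F → IntegrableOn F B := fun F hF ↦
    (hE.integrableOn hF).mono_set h.ball_subset
  set m := (volume.real B)⁻¹ * ∫ z in B, φ z with hm
  refine ⟨m, ?_⟩
  have hpt : ∀ x, volume.real B * (φ x - m) ^ 2 ≤ ∫ z in B, (φ x - φ z) ^ 2 := by
    intro x
    have hfc : Continuous fun z ↦ φ x - φ z := by fun_prop
    have hL : MemLp (fun z ↦ φ x - φ z) 2 (volume.restrict B) := by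
      rw [memLp_two_iff_integrable_sq hfc.aestronglyMeasurable]
      exact hon _ (hfc.pow 2)
    have h1 := sq_integral_le hL
    rw [integral_sub (integrable_const _) (hon _ hc), integral_const, smul_eq_mul,
      measureReal_restrict_apply_univ] at h1
    have h2 : volume.real B * φ x - ∫ z in B, φ z = volume.real B * (φ x - m) := by
      rw [hm]; field_simp
    rw [h2, mul_pow, sq (volume.real B), mul_assoc] at h1
    exact le_of_mul_le_mul_left h1 hBpos
  have hlin := h.lintegral_lintegral_sq_sub_le hφ
  have hleft : ENNReal.ofReal (volume.real B * ∫ x in E, (φ x - m) ^ 2)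
      ≤ ∫⁻ x in E, ∫⁻ z in B, ENNReal.ofReal ((φ x - φ z) ^ 2) := by
    rw [← integral_const_mul, ofReal_integral_eq_lintegral_ofReal
      (hE.integrableOn (by fun_prop)) (ae_of_all _ fun _ ↦ by positivity)]
    refine lintegral_mono fun x ↦ ?_
    rw [← ofReal_integral_eq_lintegral_ofReal (hon _ (by fun_prop))
      (ae_of_all _ fun _ ↦ sq_nonneg _)]
    exact ENNReal.ofReal_le_ofReal (hpt x)
  have hright : ENNReal.ofReal (Metric.diam E ^ 2) * (4 * (volume B + volume E) *
      ∫⁻ x in E, ENNReal.ofReal (‖∇ φ x‖ ^ 2))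
      = ENNReal.ofReal (4 * Metric.diam E ^ 2 * (volume.real B + volume.real E) *
        ∫ x in E, ‖∇ φ x‖ ^ 2) := by
    rw [← ofReal_integral_eq_lintegral_ofReal (hE.integrableOn (by fun_prop))
      (ae_of_all _ fun _ ↦ sq_nonneg _), ENNReal.ofReal_mul (by positivity),
      ENNReal.ofReal_mul (by positivity), ENNReal.ofReal_mul (by positivity),
      ENNReal.ofReal_add (by positivity) (by positivity), ofReal_measureReal hBfin,
      ofReal_measureReal hEfin]
    simp only [ENNReal.ofReal_ofNat]
    ring
  rw [hright] at hlin
  exact (ENNReal.ofReal_le_ofReal_iff (by positivity)).1 (hleft.trans hlin)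

end IsStarPolygon

/-! ### The Friedrichs inequality with edge means -/

/-- Jensen's inequality on an edge: the projection onto edgewise constants does not increase the
`L²` norm. -/
lemma edgeLength_mul_sq_mean_le {n : ℕ} {P : Polygon Plane n} {i : Fin n}
    (hL : 0 < edgeLength P i) {f : Plane → ℝ} (hf : MemLp f 2 (edgeMeasure P i)) :
    edgeLength P i * (⨍ x, f x ∂(edgeMeasure P i)) ^ 2 ≤ ∫ x, f x ^ 2 ∂(edgeMeasure P i) := by
  have h := sq_integral_le hf
  rw [edgeMeasure_real_univ] at h
  rw [average_eq, edgeMeasure_real_univ, smul_eq_mul, mul_pow]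
  calc _ = (edgeLength P i)⁻¹ * (∫ x, f x ∂(edgeMeasure P i)) ^ 2 := by field_simp
    _ ≤ (edgeLength P i)⁻¹ * (edgeLength P i * ∫ x, f x ^ 2 ∂(edgeMeasure P i)) := by gcongr
    _ = _ := by field_simp

lemma memLp_edgeMeasure {n : ℕ} {P : Polygon Plane n} {f : Plane → ℝ} (hf : Continuous f)
    (i : Fin n) : MemLp f 2 (edgeMeasure P i) :=
  (memLp_boundaryMeasure P hf).mono_measure (edgeMeasure_le_boundaryMeasure P i)

namespace IsStarPolygon

variable {n : ℕ} {P : Polygon Plane n} {E : Set Plane} {x₀ : Plane} {ρ γ : ℝ}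

lemma poincare_ball_uniform (h : IsStarPolygon P E x₀ ρ) (hγ : 0 < γ)
    (hρ : γ * Metric.diam E ≤ ρ) {φ : Plane → ℝ} (hφ : ContDiff ℝ 1 φ) :
    ∃ m : ℝ, ∫ x in E, (φ x - m) ^ 2 ≤
      4 * (1 + (γ ^ 2)⁻¹) * Metric.diam E ^ 2 * ∫ x in E, ‖∇ φ x‖ ^ 2 := by
  obtain ⟨m, hm⟩ := h.poincare_ball hφ
  refine ⟨m, ?_⟩
  have hd := h.isPolygon.diam_pos
  have hB : volume.real (Metric.ball x₀ ρ) = Real.pi * ρ ^ 2 := by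
    rw [measureReal_def, EuclideanSpace.volume_ball_fin_two, ENNReal.toReal_mul,
      ENNReal.toReal_pow, ENNReal.toReal_ofReal h.pos.le, mul_comm,
      ENNReal.toReal_ofReal Real.pi_pos.le]
  have hBpos : 0 < volume.real (Metric.ball x₀ ρ) := by
    rw [hB]; have := h.pos; positivity
  have hA : volume.real E ≤ (γ ^ 2)⁻¹ * volume.real (Metric.ball x₀ ρ) := by
    refine h.isPolygon.area_le.trans ?_
    rw [hB, inv_mul_eq_div, le_div_iff₀ (by positivity)]
    have := pow_le_pow_left₀ (by positivity) hρ 2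
    have := mul_le_mul_of_nonneg_left this Real.pi_pos.le
    linarith
  have hD : 0 ≤ ∫ x in E, ‖∇ φ x‖ ^ 2 := integral_nonneg fun _ ↦ sq_nonneg _
  refine le_of_mul_le_mul_left (hm.trans ?_) hBpos
  calc _ ≤ 4 * Metric.diam E ^ 2 * (volume.real (Metric.ball x₀ ρ) +
        (γ ^ 2)⁻¹ * volume.real (Metric.ball x₀ ρ)) * ∫ x in E, ‖∇ φ x‖ ^ 2 := by gcongr
    _ = _ := by ring

/-- A Friedrichs inequality that involves only the mean values over the edges. The constant from the
Poincaré inequality is recovered from these mean values up to a boundary term, which the trace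
inequality controls. -/
lemma friedrichs (h : IsStarPolygon P E x₀ ρ) (hγ : 0 < γ)
    (hρ : γ * Metric.diam E ≤ ρ) {φ : Plane → ℝ} (hφ : ContDiff ℝ 1 φ) :
    ∫ x in E, φ x ^ 2 ≤
      (2 + 8 * (1 + (γ ^ 2)⁻¹) * (1 + 4 / γ)) *
      (Metric.diam E ^ 2 * (∫ x in E, ‖∇ φ x‖ ^ 2) +
        Metric.diam E * ∑ i, edgeLength P i * (⨍ x, φ x ∂(edgeMeasure P i)) ^ 2) := by
  obtain ⟨m, hm⟩ := h.poincare_ball_uniform hγ hρ hφ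
  have hE := h.isPolygon
  have hd := hE.diam_pos
  have hc := hφ.continuous
  have hT := h.trace_inequality (φ := fun x ↦ φ x - m) (hφ.sub contDiff_const)
  simp only [gradient_sub_const] at hT
  set d := Metric.diam E
  set D := ∫ x in E, ‖∇ φ x‖ ^ 2
  set W := ∫ x in E, (φ x - m) ^ 2
  set X := ∑ i, ∫ x, (φ x - m) ^ 2 ∂(edgeMeasure P i)
  set κ := 4 * (1 + (γ ^ 2)⁻¹)
  set S := ∑ i, edgeLength P i * (⨍ x, φ x ∂(edgeMeasure P i)) ^ 2
  have hκ1 : 1 ≤ κ := by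
    have : 0 ≤ (γ ^ 2)⁻¹ := by positivity
    simp only [κ]; linarith
  have hD : 0 ≤ D := integral_nonneg fun _ ↦ sq_nonneg _
  have hX : 0 ≤ X := Finset.sum_nonneg fun i _ ↦ integral_nonneg fun _ ↦ sq_nonneg _
  have hWD : √W * √D ≤ κ * d * D := by
    rw [← Real.sqrt_mul' _ hD]
    apply Real.sqrt_le_iff.2 ⟨by positivity, ?_⟩
    calc W * D ≤ κ * d ^ 2 * D * D := by gcongr
      _ ≤ κ * κ * d ^ 2 * D * D := by gcongr; exact le_mul_of_one_le_left (by positivity) hκ1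
      _ = _ := by ring
  -- the boundary norm of `φ - m`
  have hXle : X ≤ 4 * κ / γ * d * D := by
    have h1 : γ * d * X ≤ γ * d * (4 * κ / γ * d * D) := by
      calc γ * d * X ≤ ρ * X := by gcongr
        _ ≤ 2 * W + 2 * d * (√W * √D) := hT
        _ ≤ 2 * (κ * d ^ 2 * D) + 2 * d * (κ * d * D) := by gcongr
        _ = γ * d * (4 * κ / γ * d * D) := by field_simp; ring
    exact le_of_mul_le_mul_left h1 (by positivity)
  have hmA : m ^ 2 * volume.real E ≤ d * (S + X) := by
    have hterm : ∀ i, edgeLength P i * m ^ 2 ≤ 2 * (edgeLength P i *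
        (⨍ x, φ x ∂(edgeMeasure P i)) ^ 2) + 2 * ∫ x, (φ x - m) ^ 2 ∂(edgeMeasure P i) := by
      intro i
      have hL := hE.edgeLength_pos i
      have h1 := edgeLength_mul_sq_mean_le hL
        (memLp_edgeMeasure (P := P) (f := fun x ↦ φ x - m) (by fun_prop) i)
      have h2 : ⨍ x, (φ x - m) ∂(edgeMeasure P i) = (⨍ x, φ x ∂(edgeMeasure P i)) - m := by
        rw [average_eq, average_eq, integral_sub (integrable_edgeMeasure P hc i)
          (integrable_const _), integral_const, edgeMeasure_real_univ, smul_sub, smul_eq_mul,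
          smul_eq_mul, smul_eq_mul, inv_mul_cancel_left₀ hL.ne']
      rw [h2] at h1
      nlinarith [mul_nonneg hL.le (sq_nonneg (2 * (⨍ x, φ x ∂(edgeMeasure P i)) - m))]
    have hsum : (∑ i, edgeLength P i) * m ^ 2 ≤ 2 * S + 2 * X := by
      rw [Finset.sum_mul, Finset.mul_sum, Finset.mul_sum, ← Finset.sum_add_distrib]
      exact Finset.sum_le_sum fun i _ ↦ hterm i
    have h3 := mul_le_mul_of_nonneg_right h.two_mul_area_le (sq_nonneg m)
    have h4 := mul_le_mul_of_nonneg_left hsum hd.le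
    nlinarith
  have hsplit : ∫ x in E, φ x ^ 2 ≤ 2 * W + 2 * (m ^ 2 * volume.real E) := by
    calc ∫ x in E, φ x ^ 2 ≤ ∫ x in E, (2 * (φ x - m) ^ 2 + 2 * m ^ 2) := by
          refine setIntegral_mono_on (hE.integrableOn (by fun_prop)) (hE.integrableOn (by fun_prop))
            hE.isOpen.measurableSet fun x _ ↦ ?_
          nlinarith [sq_nonneg (φ x - m - m)]
      _ = _ := by
          have := hE.isFiniteMeasure_restrict
          rw [integral_add (hE.integrableOn (by fun_prop)) (integrable_const _),
            integral_const_mul, integral_const, measureReal_restrict_apply_univ, smul_eq_mul]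
          simp only [W]; ring
  have hS : 0 ≤ S :=
    Finset.sum_nonneg fun i _ ↦ mul_nonneg (hE.edgeLength_pos i).le (sq_nonneg _)
  have hXd := mul_le_mul_of_nonneg_left hXle hd.le
  have hcoef : 2 + 8 * (1 + (γ ^ 2)⁻¹) * (1 + 4 / γ) = 2 + 2 * κ * (1 + 4 / γ) := by
    simp only [κ]; ring
  rw [hcoef]
  have hγ4 : 0 < 4 / γ := by positivity
  have e1 : 2 * W + 2 * (m ^ 2 * volume.real E)
      ≤ 2 * (κ * d ^ 2 * D) + 2 * (d * S + d * (4 * κ / γ * d * D)) := by linarith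
  refine (hsplit.trans e1).trans ?_
  have e2 : 0 ≤ d * S * (2 * κ * (1 + 4 / γ)) := by positivity
  have e3 : 0 ≤ d ^ 2 * D := by positivity
  have e4 : 4 * κ / γ = κ * (4 / γ) := by ring
  rw [e4]
  nlinarith

end IsStarPolygon

/-! ### The normal derivative on an edge -/

/-- Smooth cut-off functions that are `1` on the ball of radius `r`, vanish outside the ball of
radius `2 r`, and have gradient at most `K / r`, with `K` independent of `r`. -/
lemma exists_cutoff : ∃ K : ℝ, 0 < K ∧ ∀ (m : Plane) (r : ℝ), 0 < r → ∃ φ : Plane → ℝ,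
    ContDiff ℝ ∞ φ ∧ (∀ x, 0 ≤ φ x) ∧ (∀ x, ‖x - m‖ ≤ r → φ x = 1) ∧
    (∀ x, 2 * r ≤ ‖x - m‖ → φ x = 0) ∧ ∀ x, ‖∇ φ x‖ ≤ K / r := by
  let ψ : ContDiffBump (0 : Plane) := ⟨1, 2, one_pos, one_lt_two⟩
  have hψ : ContDiff ℝ ∞ ψ := ψ.contDiff
  have hcont : Continuous (fderiv ℝ ψ) := hψ.continuous_fderiv (by simp)
  obtain ⟨K, hK⟩ := (ψ.hasCompactSupport.fderiv (𝕜 := ℝ)).exists_bound_of_continuous hcont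
  refine ⟨max K 1, by positivity, fun m r hr ↦ ⟨fun x ↦ ψ (r⁻¹ • (x - m)), ?_, ?_, ?_, ?_, ?_⟩⟩
  · exact hψ.comp (by fun_prop)
  · exact fun x ↦ ψ.nonneg
  · intro x hx
    refine ψ.one_of_mem_closedBall ?_
    rw [mem_closedBall_zero_iff, norm_smul, norm_inv, Real.norm_of_nonneg hr.le,
      inv_mul_le_iff₀ hr]
    simpa [ψ] using hx
  · intro x hx
    refine ψ.zero_of_le_dist ?_
    rw [dist_zero_right, norm_smul, norm_inv, Real.norm_of_nonneg hr.le, le_inv_mul_iff₀ hr]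
    simpa [ψ, mul_comm] using hx
  · intro x
    have h1 : HasFDerivAt (fun x : Plane ↦ r⁻¹ • (x - m))
        (r⁻¹ • ContinuousLinearMap.id ℝ Plane) x :=
      ((hasFDerivAt_id x).sub_const m).const_smul r⁻¹
    have h2 := ((hψ.differentiable (by simp) (r⁻¹ • (x - m))).hasFDerivAt.comp x h1).fderiv
    have h3 : ‖∇ (fun x ↦ ψ (r⁻¹ • (x - m))) x‖ = ‖fderiv ℝ (fun x ↦ ψ (r⁻¹ • (x - m))) x‖ := by
      simp [gradient]
    have h4 : fderiv ℝ (fun x ↦ ψ (r⁻¹ • (x - m))) x = r⁻¹ • fderiv ℝ ψ (r⁻¹ • (x - m)) := by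
      refine Eq.trans h2 ?_
      ext v; simp
    rw [h3, h4, norm_smul, norm_inv, Real.norm_of_nonneg hr.le, inv_mul_eq_div]
    gcongr
    exact (hK _).trans (le_max_left _ _)

/-- Cramer's rule. -/
lemma cross_smul_eq (p q v : Plane) : cross p q • v = cross v q • p + cross p v • q := by
  ext k
  fin_cases k <;> simp [cross] <;> ring

namespace IsStarPolygon

variable {n : ℕ} {P : Polygon Plane n} {E : Set Plane} {x₀ : Plane} {ρ γ : ℝ}

/-- A boundary point near the midpoint of an edge is on this edge: it has positive coordinates
with respect to the vectors from the centre to the endpoints, so its ray from the centre meets the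
edge. -/
lemma eq_of_near_midpoint (h : IsStarPolygon P E x₀ ρ) (hγ : 0 < γ)
    (hρ : γ * Metric.diam E ≤ ρ) (hL : EdgesLong γ P E) {i j : Fin n} {t : ℝ}
    (ht : t ∈ Set.Ico (0 : ℝ) 1)
    (hn : ‖P.edgePath ℝ j t - P.edgePath ℝ i (1 / 2)‖ < γ ^ 2 * Metric.diam E / 2) : j = i := by
  have hE := h.isPolygon
  have hd := hE.diam_pos
  have hx₀ := subset_closure (h.ball_subset h.center_mem)
  set y := P.edgePath ℝ j t
  set p := P i - x₀ with hp
  set q := P (finRotate n i) - x₀ with hq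
  have hmid : P.edgePath ℝ i (1 / 2) = x₀ + (1 / 2 : ℝ) • (p + q) := by
    rw [edgePath_apply, hp, hq]; module
  have hκeq : cross p (P (finRotate n i) - P i) = cross p q := by
    simp [cross, hp, hq]; ring
  have hκ : γ ^ 2 * Metric.diam E ^ 2 ≤ |cross p q| := by
    rw [← hκeq]
    refine le_trans ?_ (h.mul_edgeLength_le_abs_cross i)
    have := mul_le_mul hρ (hL i) (by positivity) h.pos.le
    linarith
  have hκpos : 0 < |cross p q| := lt_of_lt_of_le (by positivity) hκ
  have hκne : cross p q ≠ 0 := abs_pos.1 hκpos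
  set w := y - P.edgePath ℝ i (1 / 2) with hw
  have hbound : ∀ c : ℝ, |c| ≤ ‖w‖ * Metric.diam E → 0 < 1 / 2 + c / cross p q := by
    intro c hc
    have h1 : |c / cross p q| < 1 / 2 := by
      rw [abs_div, div_lt_iff₀ hκpos]
      calc |c| ≤ ‖w‖ * Metric.diam E := hc
        _ < γ ^ 2 * Metric.diam E / 2 * Metric.diam E := by gcongr
        _ = 1 / 2 * (γ ^ 2 * Metric.diam E ^ 2) := by ring
        _ ≤ _ := by gcongr
    linarith [(abs_lt.1 h1).1]
  set α := 1 / 2 + cross w q / cross p q with hα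
  set β := 1 / 2 + cross p w / cross p q with hβ
  have hαpos : 0 < α := hbound _ ((abs_cross_le _ _).trans (by
    gcongr; exact hE.norm_sub_le_diam (hE.vertex_mem_closure _) hx₀))
  have hβpos : 0 < β := hbound _ ((abs_cross_le _ _).trans (by
    rw [mul_comm]; gcongr; exact hE.norm_sub_le_diam (hE.vertex_mem_closure _) hx₀))
  have hy : y - x₀ = α • p + β • q := by
    have h1 : w = (cross w q / cross p q) • p + (cross p w / cross p q) • q := by
      have h2 := congrArg (fun v ↦ (cross p q)⁻¹ • v) (cross_smul_eq p q w)
      simp only [smul_add, smul_smul] at h2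
      rw [inv_mul_cancel₀ hκne, one_smul] at h2
      simp only [div_eq_inv_mul]
      exact h2
    have h3 : y - x₀ = (1 / 2 : ℝ) • (p + q) + w := by rw [hw, hmid]; abel
    rw [h3, h1, hα, hβ]; module
  have hsum : 0 < α + β := by positivity
  have hτ : β / (α + β) ∈ Set.Ico (0 : ℝ) 1 :=
    ⟨by positivity, by rw [div_lt_one hsum]; linarith⟩
  have hray : y - x₀ = (α + β) • (P.edgePath ℝ i (β / (α + β)) - x₀) := by
    have h1 : P.edgePath ℝ i (β / (α + β)) - x₀ = p + (β / (α + β)) • (q - p) := by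
      rw [edgePath_apply, hp, hq, sub_sub_sub_cancel_right]; abel
    rw [hy, h1, smul_add, smul_smul, mul_div_cancel₀ _ hsum.ne']; module
  have heq := h.eq_of_ray h.center_mem
    (hE.edgePath_mem_frontier j (Set.Ico_subset_Icc_self ht))
    (hE.edgePath_mem_frontier i (Set.Ico_subset_Icc_self hτ)) hsum hray
  exact (hE.simple j i t ht _ hτ heq).1

end IsStarPolygon

/-- The values of the normal derivative are controlled by the Dirichlet norm: test the definition of
the normal derivative with a cut-off function supported near the midpoint of the edge. -/
lemma exists_abs_normalDeriv_le {γ : ℝ} (hγ : 0 < γ) : ∃ C : ℝ, 0 < C ∧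
    ∀ (n : ℕ) (P : Polygon Plane n) (E : Set Plane) (x₀ : Plane) (ρ : ℝ),
      IsStarPolygon P E x₀ ρ → γ * Metric.diam E ≤ ρ → EdgesLong γ P E →
      ∀ (u : Plane → ℝ) (c : Fin n → ℝ), MemLp (weakGrad E u) 2 (volume.restrict E) →
        HasNormalDeriv P E u c → ∀ i,
        |c i| ≤ C * (Metric.diam E)⁻¹ * √(∫ x in E, ‖weakGrad E u x‖ ^ 2) := by
  obtain ⟨K, hK, hcut⟩ := exists_cutoff
  refine ⟨8 * K * √Real.pi / γ ^ 5, by positivity, ?_⟩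
  intro n P E x₀ ρ h hρ hL u c hu hc i
  have hE := h.isPolygon
  have hd := hE.diam_pos
  -- so the parameter interval of half-length `γ² / 4` around the midpoint is inside `[0, 1]`
  have hγ1 : γ ≤ 1 := by
    have := (hL i).trans (hE.edgeLength_le_diam i)
    exact le_of_mul_le_mul_right (by linarith) hd
  set r := γ ^ 2 * Metric.diam E / 4 with hr
  have hrpos : 0 < r := by positivity
  obtain ⟨φ, hφ, hφ0, hφ1, hφz, hφg⟩ := hcut (P.edgePath ℝ i (1 / 2)) r hrpos
  have hφc := hφ.continuous
  have hgc := gradient_continuous (hφ.of_le (by simp))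
  have hoff : ∀ j, j ≠ i → ∫ x, c j * φ x ∂(edgeMeasure P j) = 0 := by
    intro j hj
    rw [integral_const_mul, integral_edgeMeasure P hφc]
    have : ∫ t in Set.Ico (0 : ℝ) 1, φ (P.edgePath ℝ j t) = 0 := by
      refine setIntegral_eq_zero_of_forall_eq_zero fun t ht ↦ hφz _ ?_
      by_contra! hlt
      refine hj (h.eq_of_near_midpoint hγ hρ hL ht (lt_of_lt_of_eq hlt ?_))
      rw [hr]; ring
    rw [this]; ring
  have hon : γ ^ 3 * Metric.diam E / 2 ≤ ∫ x, φ x ∂(edgeMeasure P i) := by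
    have hγ2 : γ ^ 2 ≤ 1 := pow_le_one₀ hγ.le hγ1
    have hsub : Set.Ioo (1 / 2 - γ ^ 2 / 4) (1 / 2 + γ ^ 2 / 4) ⊆ Set.Ico (0 : ℝ) 1 := by
      intro t ht
      exact ⟨by linarith [ht.1], by linarith [ht.2]⟩
    have hcomp : Continuous fun t ↦ φ (P.edgePath ℝ i t) := hφc.comp (continuous_edgePath P i)
    have hint : IntegrableOn (fun t ↦ φ (P.edgePath ℝ i t)) (Set.Ico (0 : ℝ) 1) :=
      (hcomp.continuousOn.integrableOn_compact isCompact_Icc).mono_set Set.Ico_subset_Icc_self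
    have hlow : γ ^ 2 / 2 ≤ ∫ t in Set.Ico (0 : ℝ) 1, φ (P.edgePath ℝ i t) := by
      calc γ ^ 2 / 2 = ∫ _t in Set.Ioo (1 / 2 - γ ^ 2 / 4) (1 / 2 + γ ^ 2 / 4), (1 : ℝ) := by
            rw [setIntegral_const, Real.volume_real_Ioo_of_le (by nlinarith [sq_nonneg γ]),
              smul_eq_mul]
            ring
        _ = ∫ t in Set.Ioo (1 / 2 - γ ^ 2 / 4) (1 / 2 + γ ^ 2 / 4), φ (P.edgePath ℝ i t) := by
            refine setIntegral_congr_fun measurableSet_Ioo fun t ht ↦ (hφ1 _ ?_).symm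
            have h1 : P.edgePath ℝ i t - P.edgePath ℝ i (1 / 2)
                = (t - 1 / 2) • (P (finRotate n i) - P i) := by
              rw [edgePath_apply, edgePath_apply]; module
            rw [h1, norm_smul, ← dist_eq_norm_edge, Real.norm_eq_abs]
            have h2 : |t - 1 / 2| ≤ γ ^ 2 / 4 :=
              abs_le.2 ⟨by linarith [ht.1], by linarith [ht.2]⟩
            calc |t - 1 / 2| * edgeLength P i ≤ γ ^ 2 / 4 * Metric.diam E :=
                  mul_le_mul h2 (hE.edgeLength_le_diam i) (hE.edgeLength_pos i).le (by positivity)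
              _ = r := by rw [hr]; ring
        _ ≤ _ := setIntegral_mono_set hint (ae_of_all _ fun t ↦ hφ0 _)
            (LE.le.eventuallyLE hsub)
    rw [integral_edgeMeasure P hφc]
    calc γ ^ 3 * Metric.diam E / 2 = (γ * Metric.diam E) * (γ ^ 2 / 2) := by ring
      _ ≤ _ := mul_le_mul (hL i) hlow (by positivity) (hE.edgeLength_pos i).le
  have hgrad : √(∫ x in E, ‖∇ φ x‖ ^ 2) ≤ K / r * (√Real.pi * Metric.diam E) := by
    apply Real.sqrt_le_iff.2 ⟨by positivity, ?_⟩
    have := hE.isFiniteMeasure_restrict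
    calc ∫ x in E, ‖∇ φ x‖ ^ 2 ≤ ∫ _x in E, (K / r) ^ 2 := by
          refine integral_mono (hE.integrableOn (by fun_prop)) (integrable_const _) fun x ↦ ?_
          exact pow_le_pow_left₀ (norm_nonneg _) (hφg x) 2
      _ = volume.real E * (K / r) ^ 2 := by simp
      _ ≤ Real.pi * Metric.diam E ^ 2 * (K / r) ^ 2 := by
          gcongr; exact hE.area_le
      _ = _ := by
          rw [mul_pow, mul_pow, Real.sq_sqrt Real.pi_pos.le]; ring
  set X := √(∫ x in E, ‖weakGrad E u x‖ ^ 2)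
  have hX : 0 ≤ X := Real.sqrt_nonneg _
  have hmain := hc φ hφ
  rw [Finset.sum_eq_single i (fun j _ hj ↦ hoff j hj) (by simp), integral_const_mul] at hmain
  have hcs := abs_integral_inner_le hu (hE.memLp hgc)
  rw [hmain, abs_mul] at hcs
  have h1 : |c i| * (γ ^ 3 * Metric.diam E / 2) ≤ X * (K / r * (√Real.pi * Metric.diam E)) := by
    calc |c i| * (γ ^ 3 * Metric.diam E / 2) ≤ |c i| * |∫ x, φ x ∂(edgeMeasure P i)| := by
          gcongr; exact hon.trans (le_abs_self _)
      _ ≤ _ := hcs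
      _ ≤ _ := by gcongr
  have h2 : 0 < γ ^ 3 * Metric.diam E / 2 := by positivity
  rw [← le_div_iff₀ h2] at h1
  refine h1.trans (le_of_eq ?_)
  rw [hr]
  field_simp
  ring

/-! ### Continuity of dilations and translations in `L²` -/

lemma eLpNorm_two_sq {α V : Type*} [MeasurableSpace α] [NormedAddCommGroup V] (f : α → V)
    (μ : Measure α) : eLpNorm f 2 μ ^ 2 = ∫⁻ x, ‖f x‖ₑ ^ 2 ∂μ := by
  have h := eLpNorm_nnreal_pow_eq_lintegral (f := f) (μ := μ) (p := 2) two_ne_zero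
  simpa using h

lemma shift_eq (x₀ : Plane) (p : ℝ × Plane) (x : Plane) :
    x₀ + p.1 • (x - x₀) - p.2 = (x₀ - p.1 • x₀ - p.2) + p.1 • x := by
  module

section L2

variable {V : Type*} [NormedAddCommGroup V]

lemma eLpNorm_comp_shift_le (f : Plane → V) (x₀ : Plane) {p : ℝ × Plane} (hp : 1 / 2 ≤ p.1) :
    eLpNorm (fun x ↦ f (x₀ + p.1 • (x - x₀) - p.2)) 2 volume ≤ 2 * eLpNorm f 2 volume := by
  rw [← ENNReal.pow_le_pow_left_iff two_ne_zero, mul_pow, eLpNorm_two_sq, eLpNorm_two_sq]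
  simp only [shift_eq]
  have h := setLIntegral_comp_add_smul_le (fun x ↦ ‖f x‖ₑ ^ 2) Set.univ (x₀ - p.1 • x₀ - p.2) hp
  simp only [Measure.restrict_univ] at h
  refine h.trans (le_of_eq ?_)
  norm_num

lemma tendsto_eLpNorm_comp_shift_sub_of_continuous {g : Plane → V} (hg : Continuous g)
    (hgs : HasCompactSupport g) (x₀ : Plane) :
    Tendsto (fun p : ℝ × Plane ↦ eLpNorm (fun x ↦ g (x₀ + p.1 • (x - x₀) - p.2) - g x) 2 volume)
      (𝓝 (1, 0)) (𝓝 0) := by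
  obtain ⟨M, hM⟩ := hgs.exists_bound_of_continuous hg
  have hM0 : 0 ≤ M := (norm_nonneg _).trans (hM 0)
  obtain ⟨R, hR⟩ := hgs.isCompact.isBounded.subset_closedBall (0 : Plane)
  have hz : ∀ x, R < ‖x‖ → g x = 0 := fun x hx ↦ image_eq_zero_of_notMem_tsupport fun h ↦ by
    have := hR h
    rw [mem_closedBall_zero_iff] at this
    linarith
  let R' := 2 * (|R| + 3 * ‖x₀‖ + 1) + |R|
  let bound : Plane → ENNReal := (Metric.closedBall (0 : Plane) R').indicator
    fun _ ↦ ENNReal.ofReal (2 * M) ^ 2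
  have hev : ∀ᶠ p : ℝ × Plane in 𝓝 (1, 0), 1 / 2 < p.1 ∧ p.1 < 2 ∧ ‖p.2‖ < 1 := by
    have h1 : ∀ᶠ p : ℝ × Plane in 𝓝 (1, 0), 1 / 2 < p.1 :=
      continuous_fst.continuousAt.eventually (lt_mem_nhds (by norm_num))
    have h2 : ∀ᶠ p : ℝ × Plane in 𝓝 (1, 0), p.1 < 2 :=
      continuous_fst.continuousAt.eventually (gt_mem_nhds (by norm_num))
    have h3 : ∀ᶠ p : ℝ × Plane in 𝓝 (1, 0), ‖p.2‖ < 1 :=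
      continuous_snd.norm.continuousAt.eventually (gt_mem_nhds (by simp))
    filter_upwards [h1, h2, h3] with p a b c using ⟨a, b, c⟩
  have hlim : Tendsto (fun p : ℝ × Plane ↦
      ∫⁻ x, ‖g (x₀ + p.1 • (x - x₀) - p.2) - g x‖ₑ ^ 2) (𝓝 (1, 0)) (𝓝 (∫⁻ _x : Plane, 0)) := by
    refine tendsto_lintegral_filter_of_dominated_convergence bound ?_ ?_ ?_ ?_
    · refine Eventually.of_forall fun p ↦ Continuous.measurable ?_
      fun_prop
    · filter_upwards [hev] with p hp
      refine ae_of_all _ fun x ↦ ?_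
      simp only [bound]
      by_cases hx : x ∈ Metric.closedBall (0 : Plane) R'
      · rw [Set.indicator_of_mem hx]
        gcongr
        rw [← ofReal_norm]
        refine ENNReal.ofReal_le_ofReal ((norm_sub_le _ _).trans ?_)
        linarith [hM (x₀ + p.1 • (x - x₀) - p.2), hM x]
      · rw [Set.indicator_of_notMem hx]
        rw [mem_closedBall_zero_iff, not_le] at hx
        have hR'R : R ≤ R' := by
          simp only [R']
          linarith [le_abs_self R, norm_nonneg x₀, abs_nonneg R]
        have h1 : ‖p.1 • x‖ ≤ ‖x₀ + p.1 • (x - x₀) - p.2‖ + (‖p.2‖ + ‖x₀‖ + ‖p.1 • x₀‖) := by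
          have he : p.1 • x = (x₀ + p.1 • (x - x₀) - p.2) + (p.2 - x₀ + p.1 • x₀) := by module
          rw [he]
          refine (norm_add_le _ _).trans ?_
          gcongr
          exact (norm_add_le _ _).trans (by gcongr; exact norm_sub_le _ _)
        rw [norm_smul, norm_smul, Real.norm_of_nonneg (by linarith [hp.1])] at h1
        have h3 : p.1 * ‖x₀‖ ≤ 2 * ‖x₀‖ := by gcongr; exact hp.2.1.le
        have h4 : 1 / 2 * ‖x‖ ≤ p.1 * ‖x‖ := by gcongr; exact hp.1.le
        have h5 : R < ‖x₀ + p.1 • (x - x₀) - p.2‖ := by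
          simp only [R'] at hx
          linarith [le_abs_self R, norm_nonneg x₀, abs_nonneg R, hp.2.2]
        rw [hz _ h5, hz _ (hR'R.trans_lt hx)]
        simp
    · simp only [bound]
      rw [lintegral_indicator measurableSet_closedBall, setLIntegral_const]
      exact ENNReal.mul_ne_top (ENNReal.pow_ne_top ENNReal.ofReal_ne_top)
        measure_closedBall_lt_top.ne
    · refine ae_of_all _ fun x ↦ ?_
      have hc : Continuous fun p : ℝ × Plane ↦
          ‖g (x₀ + p.1 • (x - x₀) - p.2) - g x‖ₑ ^ 2 := by fun_prop
      have := hc.tendsto (1, 0)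
      simpa using this
  simp only [lintegral_zero] at hlim
  have h2 : Tendsto (fun p : ℝ × Plane ↦
      eLpNorm (fun x ↦ g (x₀ + p.1 • (x - x₀) - p.2) - g x) 2 volume ^ 2) (𝓝 (1, 0)) (𝓝 0) := by
    simpa only [eLpNorm_two_sq] using hlim
  rw [ENNReal.tendsto_nhds_zero] at h2 ⊢
  intro ε hε
  filter_upwards [h2 (ε ^ 2) (by positivity)] with p hp
  exact (ENNReal.pow_le_pow_left_iff two_ne_zero).1 hp

/-- Dilations close to the identity and small translations move a function little in `L²`. -/
lemma tendsto_eLpNorm_comp_shift_sub [NormedSpace ℝ V] {f : Plane → V} (hfm : StronglyMeasurable f)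
    (hf : MemLp f 2 volume) (x₀ : Plane) :
    Tendsto (fun p : ℝ × Plane ↦ eLpNorm (fun x ↦ f (x₀ + p.1 • (x - x₀) - p.2) - f x) 2 volume)
      (𝓝 (1, 0)) (𝓝 0) := by
  rw [ENNReal.tendsto_nhds_zero]
  intro ε hε
  have hε4 : ε / 4 ≠ 0 := (ENNReal.div_pos hε.ne' (by simp)).ne'
  obtain ⟨g, hgs, hfg, hgc, hgL⟩ :=
    hf.exists_hasCompactSupport_eLpNorm_sub_le (by simp) hε4
  have h1 := ENNReal.tendsto_nhds_zero.1
    (tendsto_eLpNorm_comp_shift_sub_of_continuous hgc hgs x₀) (ε / 4) (pos_iff_ne_zero.2 hε4)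
  have h2 : ∀ᶠ p : ℝ × Plane in 𝓝 (1, 0), 1 / 2 < p.1 :=
    continuous_fst.continuousAt.eventually (lt_mem_nhds (by norm_num))
  filter_upwards [h1, h2] with p hp1 hp2
  set τ : Plane → Plane := fun x ↦ x₀ + p.1 • (x - x₀) - p.2 with hτ
  have hτm : Measurable τ := by simp only [hτ]; fun_prop
  have hfτ : AEStronglyMeasurable (fun x ↦ f (τ x)) volume :=
    (hfm.comp_measurable hτm).aestronglyMeasurable
  have hgτ : AEStronglyMeasurable (fun x ↦ g (τ x)) volume :=
    (hgc.stronglyMeasurable.comp_measurable hτm).aestronglyMeasurable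
  have hsplit : (fun x ↦ f (τ x) - f x)
      = (fun x ↦ (f - g) (τ x)) + ((fun x ↦ g (τ x) - g x) - (f - g)) := by
    ext x; simp only [Pi.add_apply, Pi.sub_apply]; abel
  have hA := eLpNorm_comp_shift_le (f - g) x₀ hp2.le
  have hgm := hgc.aestronglyMeasurable (μ := (volume : Measure Plane))
  have hfm' := hf.aestronglyMeasurable
  change eLpNorm (fun x ↦ f (τ x) - f x) 2 volume ≤ ε
  rw [hsplit]
  calc _ ≤ eLpNorm (fun x ↦ (f - g) (τ x)) 2 volume +
        eLpNorm ((fun x ↦ g (τ x) - g x) - (f - g)) 2 volume :=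
        eLpNorm_add_le (hfτ.sub hgτ) ((hgτ.sub hgm).sub (hfm'.sub hgm)) one_le_two
    _ ≤ 2 * (ε / 4) + (ε / 4 + ε / 4) := by
        gcongr
        · exact hA.trans (by gcongr)
        · exact (eLpNorm_sub_le (hgτ.sub hgm) (hfm'.sub hgm) one_le_two).trans
            (add_le_add hp1 hfg)
    _ = 4 * (ε / 4) := by ring
    _ ≤ ε := by rw [ENNReal.mul_div_cancel (by simp) (by simp)]

/-- Averaging translates with a probability density does not increase their distance to `f` in `L²`
(Jensen's inequality and Tonelli's theorem). -/
lemma eLpNorm_average_sub_le [NormedSpace ℝ V] [CompleteSpace V] {f : Plane → V}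
    (hfm : StronglyMeasurable f) (hf : MemLp f 2 volume) {η : Plane → ℝ} (hηc : Continuous η)
    (hηs : HasCompactSupport η)
    (hη0 : ∀ y, 0 ≤ η y) (hη1 : ∫ y, η y = 1) (x₀ : Plane) (l : ℝ) {b : ENNReal}
    (hb : ∀ y, η y ≠ 0 →
      eLpNorm (fun x ↦ f (x₀ + l • (x - x₀) - y) - f x) 2 volume ≤ b) :
    eLpNorm (fun x ↦ (∫ y, η y • f (x₀ + l • (x - x₀) - y)) - f x) 2 volume ≤ b := by
  have hηint : Integrable η := hηc.integrable_of_hasCompactSupport hηs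
  set w : Plane → ENNReal := fun y ↦ ENNReal.ofReal (η y) with hw
  have hwm : Measurable w := ENNReal.measurable_ofReal.comp hηc.measurable
  have hw1 : ∫⁻ y, w y = 1 := by
    rw [hw, ← ofReal_integral_eq_lintegral_ofReal hηint (ae_of_all _ hη0), hη1, ENNReal.ofReal_one]
  set ν := (volume : Measure Plane).withDensity w with hν
  have hνp : IsProbabilityMeasure ν := ⟨by rw [hν, withDensity_apply _ MeasurableSet.univ]; simpa⟩
  have hlν : ∀ F : Plane → ENNReal, Measurable F → ∫⁻ y, F y ∂ν = ∫⁻ y, w y * F y := fun F hF ↦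
    lintegral_withDensity_eq_lintegral_mul _ hwm hF
  let D : Plane → Plane → V := fun x y ↦ f (x₀ + l • (x - x₀) - y) - f x
  have hDm : StronglyMeasurable (Function.uncurry D) := by
    refine StronglyMeasurable.sub ?_ (hfm.comp_measurable measurable_fst)
    exact hfm.comp_measurable
      (show Measurable fun p : Plane × Plane ↦ x₀ + l • (p.1 - x₀) - p.2 by fun_prop)
  have hDx : ∀ x, StronglyMeasurable (D x) := fun x ↦
    (hfm.comp_measurable (show Measurable fun y : Plane ↦ x₀ + l • (x - x₀) - y by
      fun_prop)).sub stronglyMeasurable_const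
  have hpt : ∀ x, ‖(∫ y, η y • f (x₀ + l • (x - x₀) - y)) - f x‖ₑ ^ 2
      ≤ ∫⁻ y, ‖D x y‖ₑ ^ 2 ∂ν := by
    intro x
    have hcv : Integrable fun y ↦ η y • f (x₀ + l • (x - x₀) - y) :=
      ((hf.comp_measurePreserving ((volume : Measure Plane).measurePreserving_sub_left
        (x₀ + l • (x - x₀)))).locallyIntegrable
        one_le_two).integrable_smul_left_of_hasCompactSupport hηc hηs
    have heq : (∫ y, η y • f (x₀ + l • (x - x₀) - y)) - f x = ∫ y, η y • D x y := by
      have hs : ∀ y, η y • D x y = η y • f (x₀ + l • (x - x₀) - y) - η y • f x :=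
        fun y ↦ smul_sub _ _ _
      simp only [hs]
      rw [integral_sub hcv (hηint.smul_const _), integral_smul_const, hη1, one_smul]
    have h1 : ‖∫ y, η y • D x y‖ₑ ≤ ∫⁻ y, ‖D x y‖ₑ ∂ν := by
      rw [hlν _ (hDx x).enorm]
      refine (enorm_integral_le_lintegral_enorm _).trans (lintegral_mono fun y ↦ ?_)
      rw [enorm_smul, Real.enorm_of_nonneg (hη0 y)]
    have h2 := eLpNorm_le_eLpNorm_of_exponent_le (μ := ν) one_le_two
      (hDx x).aestronglyMeasurable
    rw [eLpNorm_one_eq_lintegral_enorm] at h2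
    rw [heq, ← eLpNorm_two_sq]
    gcongr
    exact h1.trans h2
  rw [← ENNReal.pow_le_pow_left_iff two_ne_zero, eLpNorm_two_sq]
  have hDsq : Measurable (Function.uncurry fun x y ↦ ‖D x y‖ₑ ^ 2) := hDm.enorm.pow_const 2
  calc _ ≤ ∫⁻ x, ∫⁻ y, ‖D x y‖ₑ ^ 2 ∂ν := lintegral_mono hpt
    _ = ∫⁻ y, (∫⁻ x, ‖D x y‖ₑ ^ 2) ∂ν := lintegral_lintegral_swap hDsq.aemeasurable
    _ = ∫⁻ y, w y * ∫⁻ x, ‖D x y‖ₑ ^ 2 := hlν _ hDsq.lintegral_prod_left'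
    _ ≤ ∫⁻ y, w y * b ^ 2 := by
        refine lintegral_mono fun y ↦ ?_
        by_cases hy : η y = 0
        · simp [hw, hy]
        · gcongr
          rw [← eLpNorm_two_sq]
          gcongr
          exact hb y hy
    _ = b ^ 2 := by rw [lintegral_mul_const _ hwm, hw1, one_mul]

end L2

/-! ### Mollification of weak gradients -/

/-- The convolution `η * f`. -/
noncomputable def mollify {V : Type*} [NormedAddCommGroup V] [NormedSpace ℝ V] (η : Plane → ℝ)
    (f : Plane → V) (z : Plane) : V :=
  ∫ y, η y • f (z - y)

lemma mollify_eq {V : Type*} [NormedAddCommGroup V] [NormedSpace ℝ V] (η : Plane → ℝ)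
    (f : Plane → V) (z : Plane) : mollify η f z = ∫ t, η (z - t) • f t := by
  rw [← integral_sub_left_eq_self _ volume z]
  simp [mollify]

lemma mollify_eq_convolution (η f : Plane → ℝ) :
    mollify η f = convolution f η (ContinuousLinearMap.lsmul ℝ ℝ) volume := by
  funext z
  rw [mollify_eq, convolution_def]
  simp [mul_comm]

section

variable {E : Set Plane} {u : Plane → ℝ} {g : Plane → Plane} {η : Plane → ℝ}

lemma contDiff_mollify {f : Plane → ℝ} (hf : LocallyIntegrable f) (hη : ContDiff ℝ ∞ η)
    (hηs : HasCompactSupport η) : ContDiff ℝ ∞ (mollify η f) := by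
  rw [mollify_eq_convolution]
  exact hηs.contDiff_convolution_right _ hf hη

lemma gradient_comp_sub (hη : ContDiff ℝ ∞ η) (z t : Plane) :
    ∇ (fun y ↦ η (z - y)) t = -∇ η (z - t) := by
  have h1 : HasFDerivAt (fun y : Plane ↦ z - y) (-ContinuousLinearMap.id ℝ Plane) t :=
    (hasFDerivAt_id t).const_sub z
  have h2 := ((hη.differentiable (by simp) (z - t)).hasFDerivAt.comp t h1).fderiv
  refine ext_inner_right ℝ fun v ↦ ?_
  rw [inner_neg_left, inner_gradient_left, inner_gradient_left]
  change fderiv ℝ (η ∘ fun y ↦ z - y) t v = _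
  rw [h2]
  simp

/-- Differentiation commutes with mollification at the points `z` for which `η (z - ·)` is a test
function in `E`, and the definition of the weak gradient applies to it. -/
lemma hasGradientAt_mollify (hE : MeasurableSet E) (hug : HasWeakGrad E u g)
    (hη : ContDiff ℝ ∞ η) (hηs : HasCompactSupport η) {z : Plane}
    (hz : tsupport (fun y ↦ η (z - y)) ⊆ E) :
    HasGradientAt (mollify η (E.indicator u)) (mollify η (E.indicator g) z) z := by
  have huL : LocallyIntegrable (E.indicator u) :=
    ((memLp_indicator_iff_restrict hE).2 hug.memLp).locallyIntegrable one_le_two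
  have hgL : LocallyIntegrable (E.indicator g) :=
    ((memLp_indicator_iff_restrict hE).2 hug.memLp_grad).locallyIntegrable one_le_two
  have hη1 : ContDiff ℝ 1 η := hη.of_le (by simp)
  have hsub : HasCompactSupport fun y ↦ η (z - y) := hηs.comp_homeomorph (Homeomorph.subLeft z)
  have htest : IsTestFunction E fun y ↦ η (z - y) := ⟨hη.comp (by fun_prop), hsub, hz⟩
  have hgrad_c : Continuous fun t ↦ ∇ η (z - t) :=
    (gradient_continuous hη1).comp (by fun_prop)
  have hgrad_s : HasCompactSupport fun t ↦ ∇ η (z - t) := by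
    have h1 : HasCompactSupport (∇ η) :=
      (hηs.fderiv (𝕜 := ℝ)).comp_left (g := (InnerProductSpace.toDual ℝ Plane).symm) (map_zero _)
    exact h1.comp_homeomorph (Homeomorph.subLeft z)
  -- the integrals over `E` as integrals over the plane
  have hind : ∀ t, E.indicator u t • ∇ η (z - t) = E.indicator (fun t ↦ u t • ∇ η (z - t)) t :=
    fun t ↦ (Set.indicator_smul_apply_left E u (fun t ↦ ∇ η (z - t)) t).symm
  have hindg : ∀ t, η (z - t) • E.indicator g t = E.indicator (fun t ↦ η (z - t) • g t) t :=
    fun t ↦ (Set.indicator_smul_apply E (fun t ↦ η (z - t)) g t).symm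
  have hweak : ∫ t, E.indicator u t • ∇ η (z - t) = mollify η (E.indicator g) z := by
    have h1 := hug.integral_eq _ htest
    simp only [gradient_comp_sub hη, smul_neg, integral_neg, neg_inj] at h1
    rw [mollify_eq]
    simp only [hind, hindg]
    rw [integral_indicator hE, integral_indicator hE, h1]
  have hd := hηs.hasFDerivAt_convolution_right (ContinuousLinearMap.lsmul ℝ ℝ) huL hη1 z
  rw [← mollify_eq_convolution] at hd
  rw [hasGradientAt_iff_hasFDerivAt]
  refine hd.congr_fderiv ?_
  ext v
  rw [InnerProductSpace.toDual_apply_apply, ← hweak, real_inner_comm, ← integral_inner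
    (huL.integrable_smul_right_of_hasCompactSupport hgrad_c hgrad_s)]
  rw [convolution_def]
  have hconv : Integrable fun t ↦ (ContinuousLinearMap.lsmul ℝ ℝ).precompR Plane
      (E.indicator u t) (fderiv ℝ η (z - t)) := by
    have hc : Continuous fun t ↦ fderiv ℝ η (z - t) :=
      (hη1.continuous_fderiv one_ne_zero).comp (by fun_prop)
    have hs : HasCompactSupport fun t ↦ fderiv ℝ η (z - t) :=
      (hηs.fderiv (𝕜 := ℝ)).comp_homeomorph (Homeomorph.subLeft z)
    refine (huL.integrable_smul_right_of_hasCompactSupport hc hs).congr (ae_of_all _ fun t ↦ ?_)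
    ext v
    simp
  rw [ContinuousLinearMap.integral_apply hconv]
  refine integral_congr_ae (ae_of_all _ fun t ↦ ?_)
  simp [inner_smul_right]

end

/-! ### Density of smooth functions in `H¹(E)` -/

lemma tendsto_eLpNorm_mollify_sub {V : Type*} [NormedAddCommGroup V] [NormedSpace ℝ V]
    [CompleteSpace V] {f : Plane → V} (hfm : StronglyMeasurable f) (hf : MemLp f 2 volume)
    (x₀ : Plane) {η : ℕ → Plane → ℝ} (hηc : ∀ m, Continuous (η m))
    (hηs : ∀ m, HasCompactSupport (η m)) (hη0 : ∀ m y, 0 ≤ η m y) (hη1 : ∀ m, ∫ y, η m y = 1)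
    {l ε : ℕ → ℝ} (hl : Tendsto l atTop (𝓝 1)) (hε : Tendsto ε atTop (𝓝 0))
    (hηε : ∀ m y, η m y ≠ 0 → ‖y‖ ≤ ε m) :
    Tendsto (fun m ↦ eLpNorm (fun x ↦ mollify (η m) f (x₀ + l m • (x - x₀)) - f x) 2 volume)
      atTop (𝓝 0) := by
  rw [ENNReal.tendsto_nhds_zero]
  intro b hb
  obtain ⟨δ, hδ, hball⟩ := Metric.eventually_nhds_iff.1
    (ENNReal.tendsto_nhds_zero.1 (tendsto_eLpNorm_comp_shift_sub hfm hf x₀) b hb)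
  have h1 : ∀ᶠ m in atTop, dist (l m) 1 < δ := hl.eventually (Metric.ball_mem_nhds 1 hδ)
  have h2 : ∀ᶠ m in atTop, ε m < δ := hε.eventually (gt_mem_nhds hδ)
  filter_upwards [h1, h2] with m hm1 hm2
  refine eLpNorm_average_sub_le hfm hf (hηc m) (hηs m) (hη0 m) (hη1 m) x₀ (l m) fun y hy ↦ ?_
  refine hball (y := (l m, y)) ?_
  rw [Prod.dist_eq, max_lt_iff, dist_zero_right]
  exact ⟨hm1, (hηε m y hy).trans_lt hm2⟩

/-- If `ψ m = l m • K m` almost everywhere, with `l m → 1` and `K m → g` in `L²`, then `ψ m → g`. -/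
lemma tendsto_eLpNorm_smul_sub {α V : Type*} [MeasurableSpace α] {μ : Measure α}
    [NormedAddCommGroup V] [NormedSpace ℝ V] {g : α → V} (hg : MemLp g 2 μ) {ψ K : ℕ → α → V}
    {l : ℕ → ℝ} (hl : Tendsto l atTop (𝓝 1)) (hl0 : ∀ m, 0 < l m) (hl1 : ∀ m, l m < 1)
    (hψ : ∀ m, AEStronglyMeasurable (ψ m) μ) (hψK : ∀ m, ∀ᵐ x ∂μ, ψ m x = l m • K m x)
    (hK : Tendsto (fun m ↦ eLpNorm (fun x ↦ K m x - g x) 2 μ) atTop (𝓝 0)) :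
    Tendsto (fun m ↦ eLpNorm (fun x ↦ ψ m x - g x) 2 μ) atTop (𝓝 0) := by
  have hGm : ∀ m, AEStronglyMeasurable (fun x ↦ K m x - g x) μ := fun m ↦ by
    refine AEStronglyMeasurable.sub (AEStronglyMeasurable.congr ((hψ m).const_smul (l m)⁻¹) ?_)
      hg.aestronglyMeasurable
    filter_upwards [hψK m] with x hx
    rw [Pi.smul_apply, hx, smul_smul, inv_mul_cancel₀ (hl0 m).ne', one_smul]
  have hl' : Tendsto (fun m ↦ ‖l m - 1‖ₑ) atTop (𝓝 0) := by
    have := (hl.sub_const 1).enorm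
    simpa using this
  have hbound : Tendsto (fun m ↦ eLpNorm (fun x ↦ K m x - g x) 2 μ +
      ‖l m - 1‖ₑ * eLpNorm g 2 μ) atTop (𝓝 0) := by
    have := hK.add (ENNReal.Tendsto.mul_const hl' (Or.inr hg.eLpNorm_ne_top))
    simpa using this
  refine tendsto_of_tendsto_of_tendsto_of_le_of_le tendsto_const_nhds hbound (fun _ ↦ zero_le)
    fun m ↦ ?_
  have hsplit : (fun x ↦ ψ m x - g x) =ᵐ[μ]
      l m • (fun x ↦ K m x - g x) + (l m - 1) • g := by
    filter_upwards [hψK m] with x hx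
    simp only [Pi.add_apply, Pi.smul_apply, hx]
    module
  change eLpNorm (fun x ↦ ψ m x - g x) 2 μ ≤ _
  rw [eLpNorm_congr_ae hsplit]
  refine (eLpNorm_add_le ((hGm m).const_smul _) (hg.aestronglyMeasurable.const_smul _)
    one_le_two).trans ?_
  rw [eLpNorm_const_smul, eLpNorm_const_smul]
  gcongr
  refine mul_le_of_le_one_left' ?_
  rw [Real.enorm_of_nonneg (hl0 m).le]
  exact ENNReal.ofReal_le_one.2 (hl1 m).le

/-- Probability densities with supports shrinking to the origin, and dilation factors tending to `1`
that contract `E` by more than the radius of these supports. -/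
lemma exists_mollifiers {ρ : ℝ} (hρ : 0 < ρ) : ∃ (l ε : ℕ → ℝ) (η : ℕ → Plane → ℝ),
    Tendsto l atTop (𝓝 1) ∧ Tendsto ε atTop (𝓝 0) ∧
    (∀ m, 0 < l m ∧ l m < 1 ∧ ε m < (1 - l m) * ρ) ∧
    (∀ m, ContDiff ℝ ∞ (η m)) ∧ (∀ m, HasCompactSupport (η m)) ∧ (∀ m y, 0 ≤ η m y) ∧
    (∀ m, ∫ y, η m y = 1) ∧ ∀ m y, η m y ≠ 0 → ‖y‖ ≤ ε m := by
  have hinv : Tendsto (fun m : ℕ ↦ 1 / ((m : ℝ) + 1 + 1)) atTop (𝓝 0) := by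
    have := (tendsto_add_atTop_iff_nat 1).2 (tendsto_one_div_add_atTop_nhds_zero_nat (𝕜 := ℝ))
    simpa using this
  have hpos : ∀ m : ℕ, 0 < 1 / ((m : ℝ) + 1 + 1) := fun m ↦ by positivity
  have hlt : ∀ m : ℕ, 1 / ((m : ℝ) + 1 + 1) < 1 := fun m ↦ by
    rw [div_lt_one (by positivity)]
    have : (0 : ℝ) ≤ m := m.cast_nonneg
    linarith
  have hεpos : ∀ m : ℕ, 0 < ρ / 2 * (1 / ((m : ℝ) + 1 + 1)) := fun m ↦
    mul_pos (half_pos hρ) (hpos m)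
  let bump : ℕ → ContDiffBump (0 : Plane) := fun m ↦
    ⟨ρ / 2 * (1 / ((m : ℝ) + 1 + 1)) / 2, ρ / 2 * (1 / ((m : ℝ) + 1 + 1)), half_pos (hεpos m),
      half_lt_self (hεpos m)⟩
  refine ⟨fun m ↦ 1 - 1 / ((m : ℝ) + 1 + 1), fun m ↦ ρ / 2 * (1 / ((m : ℝ) + 1 + 1)),
    fun m ↦ (bump m).normed volume, by simpa using hinv.const_sub 1,
    by simpa using hinv.const_mul (ρ / 2), fun m ↦ ⟨?_, ?_, ?_⟩, fun m ↦ (bump m).contDiff_normed,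
    fun m ↦ (bump m).hasCompactSupport_normed, fun m y ↦ (bump m).nonneg_normed y,
    fun m ↦ (bump m).integral_normed, fun m y hy ↦ ?_⟩
  · linarith [hlt m]
  · linarith [hpos m]
  · have := mul_pos (hpos m) hρ
    linarith
  · have h1 : y ∈ Function.support ((bump m).normed volume) := hy
    rw [(bump m).support_normed_eq, mem_ball_zero_iff] at h1
    exact h1.le

namespace IsStarPolygon

variable {n : ℕ} {P : Polygon Plane n} {E : Set Plane} {x₀ : Plane} {ρ : ℝ}

/-- Contracting towards the centre moves `x` away from the complement of `E`: the point
`x₀ + l (x - x₀)` has distance at least `(1 - l) ρ` from it. -/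
lemma closedBall_subset (h : IsStarPolygon P E x₀ ρ) {x : Plane} (hx : x ∈ E) {l ε : ℝ}
    (hl0 : 0 ≤ l) (hl1 : l < 1) (hε : ε < (1 - l) * ρ) :
    Metric.closedBall (x₀ + l • (x - x₀)) ε ⊆ E := by
  intro y hy
  rw [mem_closedBall_iff_norm] at hy
  have h1 : 0 < 1 - l := by linarith
  set z := x₀ + l • (x - x₀) with hz
  have hc : x₀ + (1 - l)⁻¹ • (y - z) ∈ Metric.ball x₀ ρ := by
    rw [mem_ball_iff_norm, add_sub_cancel_left, norm_smul, norm_inv, Real.norm_of_nonneg h1.le,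
      inv_mul_lt_iff₀ h1]
    exact hy.trans_lt hε
  have := h.add_smul_mem hc (subset_closure hx) hl0 hl1
  have he : x₀ + (1 - l)⁻¹ • (y - z) + l • (x - (x₀ + (1 - l)⁻¹ • (y - z))) = y := by
    have h2 : x₀ + (1 - l)⁻¹ • (y - z) + l • (x - (x₀ + (1 - l)⁻¹ • (y - z)))
        = z + (1 - l) • ((1 - l)⁻¹ • (y - z)) := by rw [hz]; module
    rw [h2, smul_smul, mul_inv_cancel₀ h1.ne', one_smul, add_sub_cancel]
  rwa [he] at this

lemma gradient_mollify_dilate (h : IsStarPolygon P E x₀ ρ) {u : Plane → ℝ} {g : Plane → Plane}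
    (hug : HasWeakGrad E u g) {η : Plane → ℝ} (hη : ContDiff ℝ ∞ η) (hηs : HasCompactSupport η)
    {l ε : ℝ} (hl0 : 0 ≤ l) (hl1 : l < 1) (hεl : ε < (1 - l) * ρ)
    (hηε : ∀ y, η y ≠ 0 → ‖y‖ ≤ ε) {x : Plane} (hx : x ∈ E) :
    ∇ (fun x ↦ mollify η (E.indicator u) (x₀ + l • (x - x₀))) x
      = l • mollify η (E.indicator g) (x₀ + l • (x - x₀)) := by
  have hsupp : tsupport (fun y ↦ η (x₀ + l • (x - x₀) - y)) ⊆ E := by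
    refine (closure_minimal ?_ Metric.isClosed_closedBall).trans
      (h.closedBall_subset hx hl0 hl1 hεl)
    intro y hy
    rw [mem_closedBall_iff_norm, norm_sub_rev]
    exact hηε _ hy
  have h1 := (hasGradientAt_mollify h.isPolygon.isOpen.measurableSet hug hη hηs hsupp).hasFDerivAt
  have h2 : HasFDerivAt (fun x : Plane ↦ x₀ + l • (x - x₀))
      (l • ContinuousLinearMap.id ℝ Plane) x :=
    (((hasFDerivAt_id x).sub_const x₀).const_smul l).const_add x₀
  have h3 := (HasFDerivAt.comp x h1 h2).fderiv
  refine ext_inner_right ℝ fun v ↦ ?_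
  rw [inner_gradient_left]
  change fderiv ℝ (mollify η (E.indicator u) ∘ fun x ↦ x₀ + l • (x - x₀)) x v = _
  rw [h3]
  simp [inner_smul_left]

/-- Functions smooth on the whole plane are dense in `H¹(E)`: contracting `E` towards the centre
leaves room to mollify. -/
lemma exists_smooth_approx (h : IsStarPolygon P E x₀ ρ) {u : Plane → ℝ} {g : Plane → Plane}
    (hug : HasWeakGrad E u g) : ∃ φ : ℕ → Plane → ℝ, (∀ m, ContDiff ℝ ∞ (φ m)) ∧
      Tendsto (fun m ↦ eLpNorm (fun x ↦ φ m x - u x) 2 (volume.restrict E)) atTop (𝓝 0) ∧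
      Tendsto (fun m ↦ eLpNorm (fun x ↦ ∇ (φ m) x - g x) 2 (volume.restrict E)) atTop (𝓝 0) := by
  -- a measurable representative makes Tonelli's theorem applicable to translates
  wlog hmeas : StronglyMeasurable u ∧ StronglyMeasurable g generalizing u g
  · obtain ⟨u', hu', huu'⟩ := hug.memLp.aestronglyMeasurable
    obtain ⟨g', hg', hgg'⟩ := hug.memLp_grad.aestronglyMeasurable
    have hug' : HasWeakGrad E u' g' := by
      refine ⟨hug.memLp.ae_eq huu', hug.memLp_grad.ae_eq hgg', fun φ hφ ↦ ?_⟩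
      have h1 : ∫ x in E, u' x • ∇ φ x = ∫ x in E, u x • ∇ φ x :=
        integral_congr_ae (by filter_upwards [huu'] with x hx; rw [hx])
      have h2 : ∫ x in E, φ x • g' x = ∫ x in E, φ x • g x :=
        integral_congr_ae (by filter_upwards [hgg'] with x hx; rw [hx])
      rw [h1, h2]
      exact hug.integral_eq φ hφ
    obtain ⟨φ, hφ, h1, h2⟩ := this hug' ⟨hu', hg'⟩
    refine ⟨φ, hφ, h1.congr fun m ↦ eLpNorm_congr_ae ?_, h2.congr fun m ↦ eLpNorm_congr_ae ?_⟩
    · filter_upwards [huu'] with x hx; rw [hx]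
    · filter_upwards [hgg'] with x hx; rw [hx]
  obtain ⟨hum, hgm⟩ := hmeas
  have hEm := h.isPolygon.isOpen.measurableSet
  obtain ⟨l, ε, η, hl, hε, hlε, hηd, hηs, hη0, hη1, hηε⟩ := exists_mollifiers h.pos
  have hfL : MemLp (E.indicator u) 2 volume := (memLp_indicator_iff_restrict hEm).2 hug.memLp
  have hgL : MemLp (E.indicator g) 2 volume := (memLp_indicator_iff_restrict hEm).2 hug.memLp_grad
  have hφ : ∀ m, ContDiff ℝ ∞ fun x ↦ mollify (η m) (E.indicator u) (x₀ + l m • (x - x₀)) :=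
    fun m ↦ (contDiff_mollify (hfL.locallyIntegrable one_le_two) (hηd m) (hηs m)).comp
      (by fun_prop)
  -- convergence in the plane implies convergence on `E`
  have hrestrict : ∀ {V : Type} [NormedAddCommGroup V] {f : Plane → V} {K : ℕ → Plane → V},
      Tendsto (fun m ↦ eLpNorm (fun x ↦ K m x - E.indicator f x) 2 volume) atTop (𝓝 0) →
      Tendsto (fun m ↦ eLpNorm (fun x ↦ K m x - f x) 2 (volume.restrict E)) atTop (𝓝 0) := by
    intro V _ f K hK
    refine tendsto_of_tendsto_of_tendsto_of_le_of_le tendsto_const_nhds hK (fun _ ↦ zero_le)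
      fun m ↦ ?_
    refine le_trans (le_of_eq (eLpNorm_congr_ae ?_))
      (eLpNorm_mono_measure _ (Measure.restrict_le_self (s := E)))
    filter_upwards [ae_restrict_mem hEm] with x hx
    rw [Set.indicator_of_mem hx]
  have hmf := hrestrict (tendsto_eLpNorm_mollify_sub (hum.indicator hEm) hfL x₀
    (fun m ↦ (hηd m).continuous) hηs hη0 hη1 hl hε hηε)
  have hmg := hrestrict (tendsto_eLpNorm_mollify_sub (hgm.indicator hEm) hgL x₀
    (fun m ↦ (hηd m).continuous) hηs hη0 hη1 hl hε hηε)
  refine ⟨_, hφ, hmf, tendsto_eLpNorm_smul_sub hug.memLp_grad hl (fun m ↦ (hlε m).1)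
    (fun m ↦ (hlε m).2.1) (fun m ↦ ?_) (fun m ↦ ?_) hmg⟩
  · exact (gradient_continuous ((hφ m).of_le (by simp))).aestronglyMeasurable
  · filter_upwards [ae_restrict_mem hEm] with x hx
    exact h.gradient_mollify_dilate hug (hηd m) (hηs m) (hlε m).1.le (hlε m).2.1 (hlε m).2.2
      (hηε m) hx

end IsStarPolygon

/-! ### Existence of traces -/

lemma eLpNorm_two_eq_ofReal {α V : Type*} [MeasurableSpace α] {μ : Measure α}
    [NormedAddCommGroup V] {f : α → V} (hf : MemLp f 2 μ) :
    eLpNorm f 2 μ = ENNReal.ofReal (√(∫ x, ‖f x‖ ^ 2 ∂μ)) := by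
  rw [hf.eLpNorm_eq_integral_rpow_norm two_ne_zero (by simp), Real.sqrt_eq_rpow]
  simp

section Limits

variable {α V : Type*} [MeasurableSpace α] {μ : Measure α} [NormedAddCommGroup V]
  {f : α → V} {F : ℕ → α → V}

lemma tendsto_integral_norm_sub_sq (hf : MemLp f 2 μ) (hF : ∀ m, MemLp (F m) 2 μ)
    (h : Tendsto (fun m ↦ eLpNorm (fun x ↦ F m x - f x) 2 μ) atTop (𝓝 0)) :
    Tendsto (fun m ↦ √(∫ x, ‖F m x - f x‖ ^ 2 ∂μ)) atTop (𝓝 0) := by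
  have h1 := (ENNReal.tendsto_toReal ENNReal.zero_ne_top).comp h
  refine h1.congr fun m ↦ ?_
  have h2 := eLpNorm_two_eq_ofReal ((hF m).sub hf)
  change (eLpNorm (F m - f) 2 μ).toReal = _
  rw [h2, ENNReal.toReal_ofReal (Real.sqrt_nonneg _)]
  rfl

variable [InnerProductSpace ℝ V]

lemma integrable_inner_of_memLp {g : α → V} (hf : MemLp f 2 μ) (hg : MemLp g 2 μ) :
    Integrable (fun x ↦ inner ℝ (f x) (g x)) μ :=
  (hf.norm.integrable_mul hg.norm).mono' (hf.aestronglyMeasurable.inner hg.aestronglyMeasurable)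
    (ae_of_all _ fun _x ↦ norm_inner_le_norm _ _)

lemma tendsto_integral_inner (hf : MemLp f 2 μ) (hF : ∀ m, MemLp (F m) 2 μ)
    (h : Tendsto (fun m ↦ eLpNorm (fun x ↦ F m x - f x) 2 μ) atTop (𝓝 0)) {g : α → V}
    (hg : MemLp g 2 μ) :
    Tendsto (fun m ↦ ∫ x, inner ℝ (g x) (F m x) ∂μ) atTop (𝓝 (∫ x, inner ℝ (g x) (f x) ∂μ)) := by
  have h1 := (tendsto_integral_norm_sub_sq hf hF h).const_mul (√(∫ x, ‖g x‖ ^ 2 ∂μ))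
  rw [mul_zero] at h1
  rw [tendsto_iff_dist_tendsto_zero]
  refine squeeze_zero (fun _ ↦ dist_nonneg) (fun m ↦ ?_) h1
  have h2 := abs_integral_inner_le hg ((hF m).sub hf)
  have h3 : ∫ x, inner ℝ (g x) ((F m - f) x) ∂μ
      = (∫ x, inner ℝ (g x) (F m x) ∂μ) - ∫ x, inner ℝ (g x) (f x) ∂μ := by
    simp only [Pi.sub_apply, inner_sub_right]
    exact integral_sub (integrable_inner_of_memLp hg (hF m)) (integrable_inner_of_memLp hg hf)
  rw [h3] at h2
  rw [Real.dist_eq]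
  exact h2

lemma tendsto_integral_norm_sq (hf : MemLp f 2 μ) (hF : ∀ m, MemLp (F m) 2 μ)
    (h : Tendsto (fun m ↦ eLpNorm (fun x ↦ F m x - f x) 2 μ) atTop (𝓝 0)) :
    Tendsto (fun m ↦ ∫ x, ‖F m x‖ ^ 2 ∂μ) atTop (𝓝 (∫ x, ‖f x‖ ^ 2 ∂μ)) := by
  have h1 := ((tendsto_integral_norm_sub_sq hf hF h).pow 2)
  have h2 := (tendsto_integral_inner hf hF h hf).const_mul 2
  have h3 := (h1.add h2).sub_const (∫ x, ‖f x‖ ^ 2 ∂μ)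
  have h4 : (0 : ℝ) ^ 2 + 2 * (∫ x, inner ℝ (f x) (f x) ∂μ) - ∫ x, ‖f x‖ ^ 2 ∂μ
      = ∫ x, ‖f x‖ ^ 2 ∂μ := by
    simp only [real_inner_self_eq_norm_sq]; ring
  rw [h4] at h3
  refine h3.congr fun m ↦ ?_
  rw [Real.sq_sqrt (integral_nonneg fun _ ↦ sq_nonneg _)]
  have e1 : ∀ x, ‖F m x - f x‖ ^ 2
      = ‖F m x‖ ^ 2 - 2 * inner ℝ (f x) (F m x) + ‖f x‖ ^ 2 := fun x ↦ by
    rw [norm_sub_sq_real, real_inner_comm]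
  simp only [e1]
  have i1 : Integrable (fun x ↦ ‖F m x‖ ^ 2) μ := (hF m).integrable_norm_pow two_ne_zero
  have i2 : Integrable (fun x ↦ ‖f x‖ ^ 2) μ := hf.integrable_norm_pow two_ne_zero
  have i3 : Integrable (fun x ↦ 2 * inner ℝ (f x) (F m x)) μ :=
    (integrable_inner_of_memLp hf (hF m)).const_mul 2
  have e2 : ∫ x, (‖F m x‖ ^ 2 - 2 * inner ℝ (f x) (F m x) + ‖f x‖ ^ 2) ∂μ
      = (∫ x, ‖F m x‖ ^ 2 ∂μ) - 2 * (∫ x, inner ℝ (f x) (F m x) ∂μ) + ∫ x, ‖f x‖ ^ 2 ∂μ := by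
    rw [← integral_const_mul, ← integral_sub i1 i3]
    exact integral_add (i1.sub i3) i2
  rw [e2]
  ring

end Limits

lemma MemH1.hasWeakGrad_weakGrad {E : Set Plane} {u : Plane → ℝ} (hu : MemH1 E u) :
    HasWeakGrad E u (weakGrad E u) := by
  rw [weakGrad, dif_pos hu]
  exact hu.choose_spec

namespace IsStarPolygon

variable {n : ℕ} {P : Polygon Plane n} {E : Set Plane} {x₀ : Plane} {ρ : ℝ}

/-- The trace inequality in the form of a bound on the trace operator on smooth functions. -/
lemma exists_eLpNorm_boundary_le (h : IsStarPolygon P E x₀ ρ) : ∃ C : ℝ, ∀ φ : Plane → ℝ,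
    ContDiff ℝ 1 φ → eLpNorm φ 2 (boundaryMeasure P) ≤ ENNReal.ofReal C *
      (eLpNorm φ 2 (volume.restrict E) + eLpNorm (∇ φ) 2 (volume.restrict E)) := by
  have hd := h.isPolygon.diam_pos
  refine ⟨√((2 + Metric.diam E) / ρ), fun φ hφ ↦ ?_⟩
  have hT := h.trace_inequality hφ
  have hρ := h.pos
  rw [eLpNorm_two_eq_ofReal (memLp_boundaryMeasure P hφ.continuous),
    eLpNorm_two_eq_ofReal (h.isPolygon.memLp hφ.continuous),
    eLpNorm_two_eq_ofReal (h.isPolygon.memLp (gradient_continuous hφ)),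
    ← ENNReal.ofReal_add (Real.sqrt_nonneg _) (Real.sqrt_nonneg _),
    ← ENNReal.ofReal_mul (Real.sqrt_nonneg _)]
  simp only [Real.norm_eq_abs, sq_abs]
  refine ENNReal.ofReal_le_ofReal ?_
  rw [integral_boundaryMeasure P (f := fun x ↦ φ x ^ 2) fun i ↦
    integrable_edgeMeasure P (hφ.continuous.pow 2) i]
  refine Real.sqrt_le_iff.2 ⟨by positivity, ?_⟩
  have hY : 0 ≤ ∫ x in E, φ x ^ 2 := integral_nonneg fun _ ↦ sq_nonneg _
  rw [← Real.sq_sqrt hY, Real.sqrt_sq (Real.sqrt_nonneg _)] at hT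
  set Y := √(∫ x in E, φ x ^ 2)
  set X := √(∫ x in E, ‖∇ φ x‖ ^ 2)
  have hY0 : 0 ≤ Y := Real.sqrt_nonneg _
  have hX0 : 0 ≤ X := Real.sqrt_nonneg _
  rw [mul_pow, Real.sq_sqrt (by positivity), div_mul_eq_mul_div, le_div_iff₀ hρ, mul_comm]
  refine hT.trans ?_
  nlinarith [mul_nonneg hY0 hX0, mul_nonneg hd.le (sq_nonneg Y), mul_nonneg hd.le (sq_nonneg X),
    sq_nonneg X]

/-- Every function of `H¹(E)` has a trace: by the trace inequality, the boundary values of smooth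
functions converging in `H¹(E)` form a Cauchy sequence. -/
lemma exists_isTrace (h : IsStarPolygon P E x₀ ρ) {u : Plane → ℝ} (hu : MemH1 E u) :
    ∃ t, IsTrace P E u t := by
  have hug := hu.hasWeakGrad_weakGrad
  obtain ⟨φ, hφ, h1, h2⟩ := h.exists_smooth_approx hug
  obtain ⟨C, hC⟩ := h.exists_eLpNorm_boundary_le
  have hφ1 : ∀ m, ContDiff ℝ 1 (φ m) := fun m ↦ (hφ m).of_le (by simp)
  have hφb : ∀ m, MemLp (φ m) 2 (boundaryMeasure P) := fun m ↦
    memLp_boundaryMeasure P (hφ m).continuous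
  have hφE : ∀ m, AEStronglyMeasurable (fun x ↦ φ m x - u x) (volume.restrict E) := fun m ↦
    (hφ m).continuous.aestronglyMeasurable.sub hug.memLp.aestronglyMeasurable
  have hgE : ∀ m, AEStronglyMeasurable (fun x ↦ ∇ (φ m) x - weakGrad E u x)
      (volume.restrict E) := fun m ↦
    (gradient_continuous (hφ1 m)).aestronglyMeasurable.sub hug.memLp_grad.aestronglyMeasurable
  set a : ℕ → ENNReal := fun m ↦ eLpNorm (fun x ↦ φ m x - u x) 2 (volume.restrict E)
  set b : ℕ → ENNReal := fun m ↦
    eLpNorm (fun x ↦ ∇ (φ m) x - weakGrad E u x) 2 (volume.restrict E)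
  have hbound : ∀ p : ℕ × ℕ, eLpNorm (φ p.1 - φ p.2) 2 (boundaryMeasure P) ≤
      ENNReal.ofReal C * ((a p.1 + a p.2) + (b p.1 + b p.2)) := by
    intro p
    refine (hC (φ p.1 - φ p.2) ((hφ1 p.1).sub (hφ1 p.2))).trans ?_
    gcongr
    · have he : φ p.1 - φ p.2 = (fun x ↦ φ p.1 x - u x) - fun x ↦ φ p.2 x - u x := by
        ext x; simp
      rw [he]
      exact eLpNorm_sub_le (hφE _) (hφE _) one_le_two
    · have he : ∇ (φ p.1 - φ p.2) = (fun x ↦ ∇ (φ p.1) x - weakGrad E u x) -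
          fun x ↦ ∇ (φ p.2) x - weakGrad E u x := by
        ext1 x
        have hs : fderiv ℝ (φ p.1 - φ p.2) x = fderiv ℝ (φ p.1) x - fderiv ℝ (φ p.2) x :=
          fderiv_sub ((hφ1 p.1).differentiable one_ne_zero x)
            ((hφ1 p.2).differentiable one_ne_zero x)
        simp [gradient, hs]
      rw [he]
      exact eLpNorm_sub_le (hgE _) (hgE _) one_le_two
  have hlim : Tendsto (fun p : ℕ × ℕ ↦ eLpNorm (φ p.1 - φ p.2) 2 (boundaryMeasure P)) atTop
      (𝓝 0) := by
    have hfst : Tendsto (Prod.fst : ℕ × ℕ → ℕ) atTop atTop := by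
      rw [← prod_atTop_atTop_eq]; exact tendsto_fst
    have hsnd : Tendsto (Prod.snd : ℕ × ℕ → ℕ) atTop atTop := by
      rw [← prod_atTop_atTop_eq]; exact tendsto_snd
    have h3 := ENNReal.Tendsto.const_mul (((h1.comp hfst).add (h1.comp hsnd)).add
      ((h2.comp hfst).add (h2.comp hsnd))) (Or.inr (ENNReal.ofReal_ne_top (r := C)))
    simp only [add_zero, mul_zero] at h3
    exact tendsto_of_tendsto_of_tendsto_of_le_of_le tendsto_const_nhds h3 (fun _ ↦ zero_le) hbound
  have hcauchy : CauchySeq fun m ↦ (hφb m).toLp := by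
    rw [Lp.cauchySeq_Lp_iff_cauchySeq_eLpNorm]
    refine hlim.congr fun p ↦ eLpNorm_congr_ae ?_
    filter_upwards [(hφb p.1).coeFn_toLp, (hφb p.2).coeFn_toLp] with x hx1 hx2
    simp [hx1, hx2]
  obtain ⟨t, ht⟩ := cauchySeq_tendsto_of_complete hcauchy
  refine ⟨t, hu, Lp.memLp t, φ, hφ, h1, h2, ?_⟩
  rw [Lp.tendsto_Lp_iff_tendsto_eLpNorm'] at ht
  refine ht.congr fun m ↦ eLpNorm_congr_ae ?_
  filter_upwards [(hφb m).coeFn_toLp] with x hx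
  simp [hx]

lemma isTrace_trace (h : IsStarPolygon P E x₀ ρ) {u : Plane → ℝ} (hu : MemH1 E u) :
    IsTrace P E u (trace P E u) := by
  have hex := h.exists_isTrace hu
  rw [trace, dif_pos hex]
  exact hex.choose_spec

end IsStarPolygon

/-! ### The estimates -/

section EdgeLimits

variable {n : ℕ} {P : Polygon Plane n} {t : Plane → ℝ}

lemma memLp_edgeMeasure_of_boundary {f : Plane → ℝ} (hf : MemLp f 2 (boundaryMeasure P))
    (i : Fin n) : MemLp f 2 (edgeMeasure P i) :=
  hf.mono_measure (edgeMeasure_le_boundaryMeasure P i)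

lemma tendsto_eLpNorm_edgeMeasure {φ : ℕ → Plane → ℝ}
    (h : Tendsto (fun m ↦ eLpNorm (fun x ↦ φ m x - t x) 2 (boundaryMeasure P)) atTop (𝓝 0))
    (i : Fin n) :
    Tendsto (fun m ↦ eLpNorm (fun x ↦ φ m x - t x) 2 (edgeMeasure P i)) atTop (𝓝 0) :=
  tendsto_of_tendsto_of_tendsto_of_le_of_le tendsto_const_nhds h (fun _ ↦ zero_le)
    fun _ ↦ eLpNorm_mono_measure _ (edgeMeasure_le_boundaryMeasure P i)

lemma tendsto_integral_edgeMeasure {φ : ℕ → Plane → ℝ} (hφ : ∀ m, Continuous (φ m))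
    (ht : MemLp t 2 (boundaryMeasure P))
    (h : Tendsto (fun m ↦ eLpNorm (fun x ↦ φ m x - t x) 2 (boundaryMeasure P)) atTop (𝓝 0))
    (i : Fin n) :
    Tendsto (fun m ↦ ∫ x, φ m x ∂(edgeMeasure P i)) atTop (𝓝 (∫ x, t x ∂(edgeMeasure P i))) := by
  have := tendsto_integral_inner (memLp_edgeMeasure_of_boundary ht i)
    (fun m ↦ memLp_edgeMeasure (P := P) (hφ m) i) (tendsto_eLpNorm_edgeMeasure h i)
    (memLp_const (1 : ℝ))
  simpa using this

end EdgeLimits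

namespace IsStarPolygon

variable {n : ℕ} {P : Polygon Plane n} {E : Set Plane} {x₀ : Plane} {ρ γ : ℝ}
  {u t : Plane → ℝ}

lemma trace_inequality_of_isTrace (h : IsStarPolygon P E x₀ ρ) (ht : IsTrace P E u t) :
    ρ * ∑ i, ∫ x, t x ^ 2 ∂(edgeMeasure P i) ≤ 2 * (∫ x in E, u x ^ 2) +
      2 * Metric.diam E * (√(∫ x in E, u x ^ 2) * √(∫ x in E, ‖weakGrad E u x‖ ^ 2)) := by
  obtain ⟨hu, htL, φ, hφ, h1, h2, h3⟩ := ht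
  have hug := hu.hasWeakGrad_weakGrad
  have hE := h.isPolygon
  have l1 := tendsto_integral_norm_sq hug.memLp (fun m ↦ hE.memLp (hφ m).continuous) h1
  have l2 := tendsto_integral_norm_sq hug.memLp_grad
    (fun m ↦ hE.memLp (gradient_continuous ((hφ m).of_le (by simp)))) h2
  have l3 := fun i ↦ tendsto_integral_norm_sq (memLp_edgeMeasure_of_boundary htL i)
    (fun m ↦ memLp_edgeMeasure (P := P) (hφ m).continuous i) (tendsto_eLpNorm_edgeMeasure h3 i)
  simp only [Real.norm_eq_abs, sq_abs] at l1 l3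
  refine le_of_tendsto_of_tendsto' ((tendsto_finsetSum _ fun i _ ↦ l3 i).const_mul ρ)
    ((l1.const_mul 2).add ((l1.sqrt.mul l2.sqrt).const_mul _)) fun m ↦ ?_
  exact h.trace_inequality ((hφ m).of_le (by simp))

lemma friedrichs_of_isTrace (h : IsStarPolygon P E x₀ ρ) (hγ : 0 < γ)
    (hρ : γ * Metric.diam E ≤ ρ) (ht : IsTrace P E u t) :
    ∫ x in E, u x ^ 2 ≤
      (2 + 8 * (1 + (γ ^ 2)⁻¹) * (1 + 4 / γ)) *
      (Metric.diam E ^ 2 * (∫ x in E, ‖weakGrad E u x‖ ^ 2) +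
        Metric.diam E * ∑ i, edgeLength P i * (⨍ x, t x ∂(edgeMeasure P i)) ^ 2) := by
  obtain ⟨hu, htL, φ, hφ, h1, h2, h3⟩ := ht
  have hug := hu.hasWeakGrad_weakGrad
  have hE := h.isPolygon
  have l1 := tendsto_integral_norm_sq hug.memLp (fun m ↦ hE.memLp (hφ m).continuous) h1
  have l2 := tendsto_integral_norm_sq hug.memLp_grad
    (fun m ↦ hE.memLp (gradient_continuous ((hφ m).of_le (by simp)))) h2
  have l3 : ∀ i, Tendsto (fun m ↦ ⨍ x, φ m x ∂(edgeMeasure P i)) atTop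
      (𝓝 (⨍ x, t x ∂(edgeMeasure P i))) := fun i ↦ by
    simp only [average_eq]
    exact (tendsto_integral_edgeMeasure (fun m ↦ (hφ m).continuous) htL h3 i).const_smul _
  simp only [Real.norm_eq_abs, sq_abs] at l1
  refine le_of_tendsto_of_tendsto' l1 (((l2.const_mul _).add ((tendsto_finsetSum _ fun i _ ↦
    ((l3 i).pow 2).const_mul _).const_mul _)).const_mul _) fun m ↦ ?_
  exact h.friedrichs hγ hρ ((hφ m).of_le (by simp))

/-- Green's formula for `u` against itself. -/
lemma integral_norm_sq_weakGrad (h : IsStarPolygon P E x₀ ρ) (ht : IsTrace P E u t)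
    {c : Fin n → ℝ} (hc : HasNormalDeriv P E u c) :
    ∫ x in E, ‖weakGrad E u x‖ ^ 2 = ∑ i, c i * ∫ x, t x ∂(edgeMeasure P i) := by
  obtain ⟨hu, htL, φ, hφ, h1, h2, h3⟩ := ht
  have hug := hu.hasWeakGrad_weakGrad
  have l1 := tendsto_integral_inner hug.memLp_grad
    (fun m ↦ h.isPolygon.memLp (gradient_continuous ((hφ m).of_le (by simp)))) h2 hug.memLp_grad
  have l2 : Tendsto (fun m ↦ ∑ i, ∫ x, c i * φ m x ∂(edgeMeasure P i)) atTop
      (𝓝 (∑ i, c i * ∫ x, t x ∂(edgeMeasure P i))) := by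
    refine tendsto_finsetSum _ fun i _ ↦ ?_
    simp only [integral_const_mul]
    exact (tendsto_integral_edgeMeasure (fun m ↦ (hφ m).continuous) htL h3 i).const_mul _
  simp only [real_inner_self_eq_norm_sq] at l1
  exact tendsto_nhds_unique l1 (l2.congr fun m ↦ (hc (φ m) (hφ m)).symm)

lemma perimeter_le (h : IsStarPolygon P E x₀ ρ) (hγ : 0 < γ) (hρ : γ * Metric.diam E ≤ ρ) :
    ∑ i, edgeLength P i ≤ 2 * Real.pi / γ * Metric.diam E := by
  have hd := h.isPolygon.diam_pos
  have h1 : γ * Metric.diam E * ∑ i, edgeLength P i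
      ≤ γ * Metric.diam E * (2 * Real.pi / γ * Metric.diam E) := by
    calc γ * Metric.diam E * ∑ i, edgeLength P i ≤ ρ * ∑ i, edgeLength P i :=
          mul_le_mul_of_nonneg_right hρ
            (Finset.sum_nonneg fun i _ ↦ (h.isPolygon.edgeLength_pos i).le)
      _ ≤ 2 * volume.real E := h.mul_perimeter_le
      _ ≤ 2 * (Real.pi * Metric.diam E ^ 2) := by gcongr; exact h.isPolygon.area_le
      _ = _ := by field_simp
  exact le_of_mul_le_mul_left h1 (by positivity)

/-- The Dirichlet norm is controlled by the edge means alone: the normal derivative is constant on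
each edge, so Green's formula sees only the means, and it is itself controlled by the Dirichlet
norm. -/
lemma diam_mul_integral_weakGrad_le (h : IsStarPolygon P E x₀ ρ) (hγ : 0 < γ)
    (hρ : γ * Metric.diam E ≤ ρ) (ht : IsTrace P E u t) {c : Fin n → ℝ}
    (hc : HasNormalDeriv P E u c) {C : ℝ}
    (hC : ∀ i, |c i| ≤ C * (Metric.diam E)⁻¹ * √(∫ x in E, ‖weakGrad E u x‖ ^ 2)) :
    Metric.diam E * ∫ x in E, ‖weakGrad E u x‖ ^ 2 ≤ C ^ 2 * (2 * Real.pi / γ) *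
      ∑ i, edgeLength P i * (⨍ x, t x ∂(edgeMeasure P i)) ^ 2 := by
  have hE := h.isPolygon
  have hd := hE.diam_pos
  have hG : 0 ≤ ∫ x in E, ‖weakGrad E u x‖ ^ 2 := integral_nonneg fun _ ↦ sq_nonneg _
  have hgreen := h.integral_norm_sq_weakGrad ht hc
  rw [← Real.sq_sqrt hG] at hgreen ⊢
  set X := √(∫ x in E, ‖weakGrad E u x‖ ^ 2)
  set d := Metric.diam E
  set a : Fin n → ℝ := fun i ↦ ⨍ x, t x ∂(edgeMeasure P i)
  set S := ∑ i, edgeLength P i * a i ^ 2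
  have hX0 : 0 ≤ X := Real.sqrt_nonneg _
  have hL : ∀ i, 0 < edgeLength P i := hE.edgeLength_pos
  have hint : ∀ i, ∫ x, t x ∂(edgeMeasure P i) = edgeLength P i * a i := fun i ↦ by
    simp only [a, average_eq, edgeMeasure_real_univ, smul_eq_mul]
    rw [mul_inv_cancel_left₀ (hL i).ne']
  simp only [hint] at hgreen
  rcases hX0.eq_or_lt with hX | hX
  · rw [← hX]
    have : 0 ≤ S := Finset.sum_nonneg fun i _ ↦ mul_nonneg (hL i).le (sq_nonneg _)
    simp only [ne_eq, OfNat.ofNat_ne_zero, not_false_eq_true, zero_pow, mul_zero]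
    positivity
  have h1 : X ^ 2 ≤ C * d⁻¹ * X * ∑ i, edgeLength P i * |a i| := by
    rw [hgreen, Finset.mul_sum]
    refine Finset.sum_le_sum fun i _ ↦ ?_
    calc c i * (edgeLength P i * a i) ≤ |c i| * (edgeLength P i * |a i|) := by
          refine (le_abs_self _).trans (le_of_eq ?_)
          rw [abs_mul, abs_mul, abs_of_pos (hL i)]
      _ ≤ _ := mul_le_mul_of_nonneg_right (hC i) (mul_nonneg (hL i).le (abs_nonneg _))
  have h2 : d * X ≤ C * ∑ i, edgeLength P i * |a i| := by
    have h3 : X * (d * X) ≤ X * (C * ∑ i, edgeLength P i * |a i|) := by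
      calc X * (d * X) = d * X ^ 2 := by ring
        _ ≤ d * (C * d⁻¹ * X * ∑ i, edgeLength P i * |a i|) := by gcongr
        _ = _ := by field_simp
    exact le_of_mul_le_mul_left h3 hX
  have hcs : (∑ i, edgeLength P i * |a i|) ^ 2 ≤ (∑ i, edgeLength P i) * S := by
    refine Finset.sum_sq_le_sum_mul_sum_of_sq_le_mul _ (fun i _ ↦ (hL i).le)
      (fun i _ ↦ mul_nonneg (hL i).le (sq_nonneg _)) fun i _ ↦ ?_
    rw [mul_pow, sq_abs]; exact le_of_eq (by ring)
  have hS : 0 ≤ S := Finset.sum_nonneg fun i _ ↦ mul_nonneg (hL i).le (sq_nonneg _)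
  have h4 : d * (d * X ^ 2) ≤ d * (C ^ 2 * (2 * Real.pi / γ) * S) := by
    calc d * (d * X ^ 2) = (d * X) ^ 2 := by ring
      _ ≤ (C * ∑ i, edgeLength P i * |a i|) ^ 2 := pow_le_pow_left₀ (by positivity) h2 2
      _ = C ^ 2 * (∑ i, edgeLength P i * |a i|) ^ 2 := by ring
      _ ≤ C ^ 2 * ((2 * Real.pi / γ * d) * S) := by
          gcongr
          exact hcs.trans (mul_le_mul_of_nonneg_right (h.perimeter_le hγ hρ) hS)
      _ = _ := by ring
  exact le_of_mul_le_mul_left h4 hd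

end IsStarPolygon

/-- The two estimates for one component, in squared form. -/
lemma exists_scalar_estimates {γ : ℝ} (hγ : 0 < γ) : ∃ K : ℝ, 0 < K ∧
    ∀ (n : ℕ) (P : Polygon Plane n) (E : Set Plane) (x₀ : Plane) (ρ : ℝ),
      IsStarPolygon P E x₀ ρ → γ * Metric.diam E ≤ ρ → EdgesLong γ P E →
      ∀ (u t : Plane → ℝ) (c : Fin n → ℝ), IsTrace P E u t → HasNormalDeriv P E u c →
        Metric.diam E ^ 2 * ∫ x in E, ‖weakGrad E u x‖ ^ 2 ≤ K * ∫ x in E, u x ^ 2 ∧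
        ∫ x in E, u x ^ 2 ≤ K * (Metric.diam E *
          ∑ i, edgeLength P i * (⨍ x, t x ∂(edgeMeasure P i)) ^ 2) := by
  obtain ⟨C, hC0, hC⟩ := exists_abs_normalDeriv_le hγ
  set κ := C ^ 2 * (2 * Real.pi / γ) with hκ
  set F := 2 + 8 * (1 + (γ ^ 2)⁻¹) * (1 + 4 / γ) with hF
  have hκ0 : 0 < κ := by positivity
  have hF0 : 0 < F := by positivity
  refine ⟨(2 * κ / γ + 1) ^ 2 + F * (κ + 1), by positivity, ?_⟩
  intro n P E x₀ ρ h hρ hL u t c ht hc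
  have hE := h.isPolygon
  have hd := hE.diam_pos
  have hdir := h.diam_mul_integral_weakGrad_le hγ hρ ht hc
    (hC n P E x₀ ρ h hρ hL u c ht.1.hasWeakGrad_weakGrad.memLp_grad hc)
  have htr := h.trace_inequality_of_isTrace ht
  have hfr := h.friedrichs_of_isTrace hγ hρ ht
  have hY0 : 0 ≤ ∫ x in E, u x ^ 2 := integral_nonneg fun _ ↦ sq_nonneg _
  have hX0 : 0 ≤ ∫ x in E, ‖weakGrad E u x‖ ^ 2 := integral_nonneg fun _ ↦ sq_nonneg _
  have hS : ∑ i, edgeLength P i * (⨍ x, t x ∂(edgeMeasure P i)) ^ 2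
      ≤ ∑ i, ∫ x, t x ^ 2 ∂(edgeMeasure P i) := Finset.sum_le_sum fun i _ ↦
    edgeLength_mul_sq_mean_le (hE.edgeLength_pos i)
      (memLp_edgeMeasure_of_boundary ht.2.1 i)
  set S := ∑ i, edgeLength P i * (⨍ x, t x ∂(edgeMeasure P i)) ^ 2
  have hS0 : 0 ≤ S :=
    Finset.sum_nonneg fun i _ ↦ mul_nonneg (hE.edgeLength_pos i).le (sq_nonneg _)
  set B := ∑ i, ∫ x, t x ^ 2 ∂(edgeMeasure P i)
  set d := Metric.diam E
  constructor
  · rw [← Real.sq_sqrt hX0, ← Real.sq_sqrt hY0] at *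
    set X := √(∫ x in E, ‖weakGrad E u x‖ ^ 2)
    set Y := √(∫ x in E, u x ^ 2)
    have hXn : 0 ≤ X := Real.sqrt_nonneg _
    have hYn : 0 ≤ Y := Real.sqrt_nonneg _
    simp only [Real.sqrt_sq hXn, Real.sqrt_sq hYn] at htr
    have hB0 : 0 ≤ B := hS0.trans hS
    have h1 : γ * d * B ≤ 2 * Y ^ 2 + 2 * d * (Y * X) :=
      (mul_le_mul_of_nonneg_right hρ hB0).trans htr
    -- a quadratic inequality for `d X`
    have h2 : (d * X) ^ 2 ≤ 2 * κ / γ * (Y ^ 2 + Y * (d * X)) := by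
      calc (d * X) ^ 2 = d * (d * X ^ 2) := by ring
        _ ≤ d * (κ * B) := by
            exact mul_le_mul_of_nonneg_left
              (hdir.trans (mul_le_mul_of_nonneg_left hS hκ0.le)) hd.le
        _ = κ / γ * (γ * d * B) := by field_simp
        _ ≤ κ / γ * (2 * Y ^ 2 + 2 * d * (Y * X)) := by gcongr
        _ = _ := by ring
    have h3 : d * X ≤ (2 * κ / γ + 1) * Y := by
      by_contra! hlt
      have hk : 0 < 2 * κ / γ := by positivity
      set k := 2 * κ / γ
      have hYZ : Y ≤ d * X := by nlinarith
      have hZ : 0 < d * X := lt_of_le_of_lt (by positivity) hlt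
      nlinarith [mul_le_mul_of_nonneg_left hYZ (mul_nonneg hk.le hYn),
        mul_lt_mul_of_pos_right hlt hZ, mul_le_mul_of_nonneg_left hYZ hYn]
    have h4 := pow_le_pow_left₀ (by positivity) h3 2
    have h5 : 0 ≤ F * (κ + 1) * Y ^ 2 := by positivity
    calc d ^ 2 * X ^ 2 = (d * X) ^ 2 := by ring
      _ ≤ ((2 * κ / γ + 1) * Y) ^ 2 := h4
      _ ≤ _ := by linarith
  · have h1 : d ^ 2 * ∫ x in E, ‖weakGrad E u x‖ ^ 2 ≤ d * (κ * S) := by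
      calc d ^ 2 * ∫ x in E, ‖weakGrad E u x‖ ^ 2
          = d * (d * ∫ x in E, ‖weakGrad E u x‖ ^ 2) := by ring
        _ ≤ _ := by gcongr
    calc ∫ x in E, u x ^ 2 ≤ F * (d ^ 2 * (∫ x in E, ‖weakGrad E u x‖ ^ 2) + d * S) := hfr
      _ ≤ F * (d * (κ * S) + d * S) := by gcongr
      _ = F * (κ + 1) * (d * S) := by ring
      _ ≤ _ := by
          gcongr
          exact le_add_of_nonneg_left (by positivity)

lemma edgeProj_apply {n : ℕ} {P : Polygon Plane n} {E : Set Plane} {v : Plane → Plane} {i : Fin n}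
    (hv : ∀ k, MemLp (trace P E fun y ↦ v y k) 2 (boundaryMeasure P)) (k : Fin 2) :
    edgeProj P (vecTrace P E v) i k = ⨍ x, trace P E (fun y ↦ v y k) x ∂(edgeMeasure P i) := by
  have hi : ∀ k, Integrable (trace P E fun y ↦ v y k) (edgeMeasure P i) := fun k ↦
    (memLp_edgeMeasure_of_boundary (hv k) i).integrable one_le_two
  have hint : Integrable (vecTrace P E v) (edgeMeasure P i) := by
    refine Integrable.of_eval_piLp fun k ↦ ?_
    exact hi k
  rw [edgeProj, average_eq, average_eq, PiLp.smul_apply]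
  congr 1
  exact ((EuclideanSpace.proj k : Plane →L[ℝ] ℝ).integral_comp_comm hint).symm

end VEM

theorem mainTheorem5 (γ : ℝ) (hγ : 0 < γ) :
    ∃ C : ℝ, 0 < C ∧
      ∀ (n : ℕ) (P : Polygon VEM.Plane n) (E : Set VEM.Plane), VEM.IsPolygon P E →
        VEM.EdgesLong γ P E → VEM.StarShapedWrtBall γ E →
        ∀ v ∈ VEM.nonconformingSpace P E,
          VEM.seminormH1 E v ≤ C * (Metric.diam E)⁻¹ * VEM.normL2 E v ∧
          VEM.normL2 E v ≤
            C * √(Metric.diam E) * VEM.normBdry P (VEM.edgeProj P (VEM.vecTrace P E v)) := by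
  obtain ⟨K, hK, hest⟩ := VEM.exists_scalar_estimates hγ
  refine ⟨√K, Real.sqrt_pos.2 hK, ?_⟩
  intro n P E hE hL hstar v hv
  have hd := hE.diam_pos
  obtain ⟨x₀, ρ, hρ, hball, hst⟩ := hstar
  have h : VEM.IsStarPolygon P E x₀ ρ :=
    ⟨hE, lt_of_lt_of_le (mul_pos hγ hd) hρ, hball, hst⟩
  have htr : ∀ k, VEM.IsTrace P E (fun x ↦ v x k) (VEM.trace P E fun x ↦ v x k) := fun k ↦
    h.isTrace_trace (hv k).1
  have hcomp := fun k : Fin 2 ↦ (hv k).2.2.elim fun c hc ↦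
    hest n P E x₀ ρ h hρ hL _ _ c (htr k) hc
  have hnorm : ∫ x in E, ‖v x‖ ^ 2 = ∑ k : Fin 2, ∫ x in E, v x k ^ 2 := by
    rw [← integral_finsetSum _ fun k _ ↦ ?_]
    · simp only [EuclideanSpace.norm_sq_eq, Real.norm_eq_abs, sq_abs]
    · exact ((hv k).1.hasWeakGrad_weakGrad.memLp).integrable_sq
  have hbdry : ∑ i, ∫ _x, ‖VEM.edgeProj P (VEM.vecTrace P E v) i‖ ^ 2 ∂(VEM.edgeMeasure P i)
      = ∑ k : Fin 2, ∑ i, VEM.edgeLength P i *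
        (⨍ x, VEM.trace P E (fun y ↦ v y k) x ∂(VEM.edgeMeasure P i)) ^ 2 := by
    rw [Finset.sum_comm]
    refine Finset.sum_congr rfl fun i _ ↦ ?_
    rw [integral_const, VEM.edgeMeasure_real_univ, smul_eq_mul, EuclideanSpace.norm_sq_eq,
      Finset.mul_sum]
    refine Finset.sum_congr rfl fun k _ ↦ ?_
    rw [VEM.edgeProj_apply (fun k ↦ (htr k).2.1), Real.norm_eq_abs, sq_abs]
  constructor
  · rw [VEM.seminormH1, VEM.normL2, hnorm]
    refine Real.sqrt_le_iff.2 ⟨by positivity, ?_⟩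
    rw [mul_pow, mul_pow, Real.sq_sqrt hK.le,
      Real.sq_sqrt (Finset.sum_nonneg fun k _ ↦ integral_nonneg fun _ ↦ sq_nonneg _), inv_pow,
      mul_right_comm, ← div_eq_mul_inv, le_div_iff₀ (by positivity), mul_comm, Finset.mul_sum,
      Finset.mul_sum]
    exact Finset.sum_le_sum fun k _ ↦ (hcomp k).1
  · rw [VEM.normL2, VEM.normBdry, hnorm, hbdry]
    refine Real.sqrt_le_iff.2 ⟨by positivity, ?_⟩
    rw [mul_pow, mul_pow, Real.sq_sqrt hK.le, Real.sq_sqrt hd.le,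
      Real.sq_sqrt (Finset.sum_nonneg fun k _ ↦ Finset.sum_nonneg fun i _ ↦
        mul_nonneg (hE.edgeLength_pos i).le (sq_nonneg _)), mul_assoc, Finset.mul_sum,
      Finset.mul_sum]
    exact Finset.sum_le_sum fun k _ ↦ (hcomp k).2
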